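/- For a weighted graph $G$ on $n$ vertices with real (possibly negative) edge weights $w_{uv}=w_{vu}$ ($w_{uv}=0$ if $uv$ is not an edge), let $e(G)=\sum_{u<v}w_{uv}$, let $L$ be its Laplacian matrix, with entries $-w_{uv}$ for $u\ne v$ and $\sum_{j\neq u}w_{uj}$ on the diagonal, and let $\lambda_1\ge\dots\ge\lambda_n$ be the eigenvalues of $L$. Let $(G_n)_{n\ge1}$ be a sequence of random weighted graphs on a common probability space, $G_n$ having $n$ vertices and edge weights $\xi^{(n)}_{ij}=\xi^{(n)}_{ji}$, $i\ne j$. Assume that for each $n$ the variables $\xi^{(n)}_{ij}$, $i<j$, are independent (not necessarily identically distributed), with $\mathbb E[\xi^{(n)}_{ij}]=\mu_n$ and $\operatorname{Var}[\xi^{(n)}_{ij}]=\sigma_n^2$, $\sigma_n>0$; that all the $\xi^{(n)}_{ij}$ are bounded, almost surely, by one constant independent of $i,j,n$; and that $$\sup_{i,j,n}\mathbb E\left[\left|(\xi^{(n)}_{ij}-\mu_n)/\sigma_n\right|^p\right]<\infty\quad\text{for some }p>6.$$ If $$\frac{\mu_n}{\sigma_n}\left(\frac{n}{\log n}\right)^{1/2}\to0\quad\text{and}\quad\sigma_n^2\,\frac{\log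 n}{\mu_n n}\to0\quad\text{as }n\to\infty,$$ then there is a constant $C>0$ such that for all sufficiently large $n$ $$\mathbb P\left[\sum_{i=1}^k\lambda_i\le e(G_n)+\binom{k+1}{2}\ \text{ for all }k=1,\dots,n\right]\ge 1-\exp(-C\mu_n n),$$ where $\lambda_1\ge\dots\ge\lambda_n$ are the Laplacian eigenvalues of $G_n$. -/

import Mathlib

open MeasureTheory ProbabilityTheory Filter Topology

/-- A weighted graph on the vertex set `{0, …, n - 1}`, given by its (possibly negative) edge
weights; the weight is `0` for pairs that are not edges, in particular on the diagonal. -/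
structure WeightedGraph (n : ℕ) where
  weight : Fin n → Fin n → ℝ
  weight_symm : ∀ u v, weight u v = weight v u
  weight_self : ∀ u, weight u u = 0

/-- The total edge weight `e(G)`, each unordered pair of vertices being counted once. -/
noncomputable def WeightedGraph.totalWeight {n : ℕ} (G : WeightedGraph n) : ℝ :=
  ∑ u : Fin n, ∑ v ∈ Finset.univ.filter (fun v : Fin n => u < v), G.weight u v

/-- The Laplacian matrix of a weighted graph: `-w_{uv}` off the diagonal and
`∑_{j ≠ u} w_{uj}` on the diagonal. -/
noncomputable def WeightedGraph.laplacian {n : ℕ} (G : WeightedGraph n) :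
    Matrix (Fin n) (Fin n) ℝ :=
  Matrix.of fun u v =>
    if u = v then ∑ j ∈ Finset.univ.filter (fun j : Fin n => j ≠ u), G.weight u j
    else -G.weight u v

theorem WeightedGraph.laplacian_isHermitian {n : ℕ} (G : WeightedGraph n) :
    G.laplacian.IsHermitian := by
  ext u v
  by_cases h : u = v
  · subst h
    simp [WeightedGraph.laplacian]
  · have h' : ¬ v = u := fun e => h e.symm
    simp [WeightedGraph.laplacian, h, h', G.weight_symm u v]

/-- `λ_1 + … + λ_k`, the sum of the `k` largest Laplacian eigenvalues with multiplicity
(`Matrix.IsHermitian.eigenvalues₀` lists the eigenvalues in nonincreasing order). -/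
noncomputable def WeightedGraph.sumLargest {n : ℕ} (G : WeightedGraph n) (k : ℕ) : ℝ :=
  ∑ i ∈ Finset.univ.filter (fun i : Fin (Fintype.card (Fin n)) => (i : ℕ) < k),
    G.laplacian_isHermitian.eigenvalues₀ i

/-- Brouwer's inequality `λ_1 + … + λ_k ≤ e(G) + (k+1 choose 2)` for all `k = 1, …, n`. -/
def WeightedGraph.SatisfiesBrouwer {n : ℕ} (G : WeightedGraph n) : Prop :=
  ∀ k : ℕ, 1 ≤ k → k ≤ n → G.sumLargest k ≤ G.totalWeight + ((k + 1).choose 2 : ℝ)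

/-- The standing condition on a sequence of random weighted graphs `G n` (on `n` vertices), all
defined on one probability space: for each `n` the weights of the pairs `i < j` are independent
random variables with common mean `μ n` and common variance `(σ n) ^ 2`, all weights are uniformly
bounded, and the normalized weights have uniformly bounded absolute moments of some order
`p > 6`. -/
structure IsRandomGraphSequence {Ω : Type*} [MeasurableSpace Ω] (P : Measure Ω)
    (G : (n : ℕ) → Ω → WeightedGraph n) (μ σ : ℕ → ℝ) : Prop where
  measurable : ∀ (n : ℕ) (i j : Fin n), i < j → Measurable fun ω => (G n ω).weight i j
  indep : ∀ n : ℕ, iIndepFun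
    (fun (e : {e : Fin n × Fin n // e.1 < e.2}) (ω : Ω) => (G n ω).weight e.1.1 e.1.2) P
  bounded : ∃ B : ℝ, ∀ (n : ℕ) (i j : Fin n), i < j → ∀ᵐ ω ∂P, |(G n ω).weight i j| ≤ B
  mean : ∀ (n : ℕ) (i j : Fin n), i < j → ∫ ω, (G n ω).weight i j ∂P = μ n
  var : ∀ (n : ℕ) (i j : Fin n), i < j →
    variance (fun ω => (G n ω).weight i j) P = (σ n) ^ 2
  sd_pos : ∀ n : ℕ, 1 ≤ n → 0 < σ n
  moment : ∃ p : ℝ, 6 < p ∧ ∃ M : ℝ, ∀ (n : ℕ) (i j : Fin n), i < j →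
    ∫ ω, |((G n ω).weight i j - μ n) / σ n| ^ p ∂P ≤ M

/-!
Write `w_e = μ + y_e`, with `μ = μ n > 0`. By `k Λ ≤ Λ ^ 2 / 2 + k ^ 2 / 2`, Brouwer's inequality holds
for all `k` at once as soon as no Laplacian eigenvalue exceeds `Λ` and the total weight is at least
`Λ ^ 2 / 2`. The total weight is about `μ n ^ 2 / 2`, so it suffices that the eigenvalues are at most
a constant times `n √μ`. The constant part of the weights contributes only `n μ` to the largest
eigenvalue, and `μ → 0` by the first hypothesis. What is left is the Laplacian of `y`, a diagonal
matrix of row sums minus a symmetric matrix with independent centred entries. Both parts are typically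
of size at most `σ √(n log n)`, which is much smaller than `n √μ` by the second hypothesis
(`WeightedGraph.satisfiesBrouwer_of_isSpectrallyBounded`).

The row sums are controlled by Bernstein's inequality. The matrix is controlled by the trace method,
in a crude form that loses the factor `√(log n)`, which the second hypothesis allows. In the expected
trace of the power `2 k`, only closed walks that use each edge at least twice contribute. They have at
most `k` edges, hence at most `k + 1` vertices, and the walks are counted with a weight `a ^ V`, where
`V` is the number of vertices, by adding one vertex at a time (`sum_pow_walkVertices_le`). The result
is `E tr ≤ n (8 n k v) ^ k` for entries of variance at most `v` and bounded by `R`, if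
`2 k R ^ 2 ≤ n v` (`IsCenteredFamily.integral_trace_pow_le`). Together this gives the tail bound
`IsCenteredFamily.measureReal_not_isSpectrallyBounded_le`.

There are three cases. If `μ ≤ 0`, the claimed lower bound is not positive. If `μ n ≥ 1`, the moment
order `k` is taken to be about `log n + c μ n`, the bound on the weights serves as `R`, and Bernstein's
inequality for the total weight completes the proof. If `0 < μ n ≤ 1`, then `1 - exp (-C μ n) ≤ C`, so
it suffices that the probability is bounded below by a constant. In this case the total weight need
not be concentrated around its mean, but it is at least its mean with probability bounded below, by a
one-sided Paley–Zygmund inequality (`le_measureReal_nonneg_of_moments`). The weights may now be large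
compared with `σ`; they are truncated at `σ n ^ (1 / 3)`, which changes none of them with high
probability because moments of some order `p > 6` are bounded.
-/

/-! ### Walks on a finite vertex set -/

theorem Fintype.sum_fin_cons {α : Type*} [Fintype α] {m : ℕ} (F : (Fin (m + 1) → α) → ℝ) :
    ∑ w, F w = ∑ w : Fin m → α, ∑ v, F (Fin.cons v w) := by
  rw [← (Fin.consEquiv (fun _ : Fin (m + 1) => α)).sum_comp, Fintype.sum_prod_type,
    Finset.sum_comm]
  rfl

theorem Matrix.pow_apply_eq_sum_walks {α : Type*} [Fintype α] [DecidableEq α]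
    (A : Matrix α α ℝ) (m : ℕ) (i j : α) :
    (A ^ m) i j = ∑ w : Fin (m + 1) → α,
      if w 0 = i ∧ w (Fin.last m) = j then ∏ s : Fin m, A (w s.castSucc) (w s.succ) else 0 := by
  induction m generalizing i with
  | zero =>
    rw [Fintype.sum_fin_cons]
    simp [Matrix.one_apply, Finset.filter_and, Finset.filter_eq']
    by_cases h : i = j <;> simp [h]
  | succ m ih =>
    rw [pow_succ', Matrix.mul_apply, Fintype.sum_fin_cons]
    simp_rw [ih, Finset.mul_sum]
    rw [Finset.sum_comm]
    refine Finset.sum_congr rfl fun w _ => ?_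
    simp only [Fin.cons_zero, Fin.prod_univ_succ, Fin.castSucc_zero, Fin.cons_succ,
      ← Fin.succ_last, ← Fin.succ_castSucc]
    by_cases h : w (Fin.last m) = j <;> simp [h]

theorem Matrix.trace_pow_eq_sum_walks {α : Type*} [Fintype α] [DecidableEq α]
    (A : Matrix α α ℝ) (m : ℕ) :
    (A ^ m).trace = ∑ w : Fin (m + 1) → α,
      if w (Fin.last m) = w 0 then ∏ s : Fin m, A (w s.castSucc) (w s.succ) else 0 := by
  simp_rw [Matrix.trace, Matrix.diag_apply, Matrix.pow_apply_eq_sum_walks]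
  rw [Finset.sum_comm]
  refine Finset.sum_congr rfl fun w _ => ?_
  simp [ite_and]

/-- The number of distinct vertices of a walk. -/
def walkVertices {α : Type*} [DecidableEq α] {m : ℕ} (w : Fin m → α) : ℕ :=
  (Finset.univ.image w).card

theorem image_fin_cons {α : Type*} [DecidableEq α] {m : ℕ} (v : α) (w : Fin m → α) :
    Finset.univ.image (Fin.cons v w : Fin (m + 1) → α) = insert v (Finset.univ.image w) := by
  ext x
  simp [Fin.exists_fin_succ, eq_comm]

/-- A walk is built by prepending vertices: at each step at most `m` choices are old vertices, and
each of the new ones costs a factor `a`. -/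
theorem sum_pow_walkVertices_le {α : Type*} [Fintype α] [DecidableEq α] {a : ℝ} (ha : 0 ≤ a)
    (m : ℕ) :
    ∑ w : Fin (m + 1) → α, a ^ walkVertices w ≤
      (Fintype.card α * a) * (Fintype.card α * a + m) ^ m := by
  have step : ∀ (m : ℕ) (w : Fin m → α), ∑ v, a ^ walkVertices (Fin.cons v w : Fin (m + 1) → α) ≤
      a ^ walkVertices w * (Fintype.card α * a + m) := by
    intro m w
    have hcard : ((Finset.univ.image w).card : ℝ) ≤ m := by
      exact_mod_cast Finset.card_image_le.trans (by simp)
    calc ∑ v, a ^ walkVertices (Fin.cons v w : Fin (m + 1) → α)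
        ≤ ∑ v, (a ^ walkVertices w * a +
            if v ∈ Finset.univ.image w then a ^ walkVertices w else 0) := by
          refine Finset.sum_le_sum fun v _ => ?_
          unfold walkVertices
          rw [image_fin_cons]
          by_cases hv : v ∈ Finset.univ.image w
          · rw [Finset.insert_eq_of_mem hv, if_pos hv]
            have := mul_nonneg (pow_nonneg ha (Finset.univ.image w).card) ha
            linarith
          · rw [Finset.card_insert_of_notMem hv, if_neg hv, pow_succ, add_zero]
      _ = a ^ walkVertices w * (Fintype.card α * a + (Finset.univ.image w).card) := by
          rw [Finset.sum_add_distrib, Finset.sum_ite_mem]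
          simp
          ring
      _ ≤ _ := by gcongr
  have base : ∑ w : Fin 0 → α, a ^ walkVertices w = 1 := by simp [walkVertices]
  induction m with
  | zero =>
    rw [Fintype.sum_fin_cons]
    refine (Finset.sum_le_sum fun w _ => step 0 w).trans ?_
    rw [← Finset.sum_mul, base]
    simp
  | succ m ih =>
    rw [Fintype.sum_fin_cons]
    refine (Finset.sum_le_sum fun w _ => step _ w).trans ?_
    rw [← Finset.sum_mul]
    have h0 : (0 : ℝ) ≤ Fintype.card α * a := by positivity
    calc _ ≤ (Fintype.card α * a) * (Fintype.card α * a + m) ^ m *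
          (Fintype.card α * a + (m + 1 : ℕ)) := by gcongr
      _ ≤ (Fintype.card α * a) * (Fintype.card α * a + (m + 1 : ℕ)) ^ m *
          (Fintype.card α * a + (m + 1 : ℕ)) := by
          gcongr
          omega
      _ = _ := by rw [pow_succ]; ring

/-- A connected graph has at most one vertex more than it has edges; here the graph is the one
traced by a walk. The hypothesis says that the label `f s` of the `s`-th step determines the
endpoints of that step. -/
theorem walkVertices_le_card_image_add_one {α ι : Type*} [DecidableEq α] [DecidableEq ι] {m : ℕ}
    (w : Fin (m + 1) → α) (f : Fin m → ι)
    (hf : ∀ s s', f s = f s' →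
      s(w s.castSucc, w s.succ) = s(w s'.castSucc, w s'.succ)) :
    walkVertices w ≤ (Finset.univ.image f).card + 1 := by
  induction m with
  | zero => simp [walkVertices]
  | succ m ih =>
    obtain ⟨v, w, rfl⟩ : ∃ v w', w = Fin.cons v w' := ⟨w 0, Fin.tail w, by simp⟩
    obtain ⟨g, f, rfl⟩ : ∃ v w', f = Fin.cons v w' := ⟨f 0, Fin.tail f, by simp⟩
    have ih' := ih w f fun s s' h => by
      simpa [← Fin.succ_castSucc] using hf s.succ s'.succ (by simpa using h)
    unfold walkVertices at ih' ⊢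
    rw [image_fin_cons, image_fin_cons]
    by_cases hv : v ∈ Finset.univ.image w
    · rw [Finset.insert_eq_of_mem hv]
      exact ih'.trans (by gcongr; exact Finset.subset_insert _ _)
    · have hg : g ∉ Finset.univ.image f := by
        intro hg
        obtain ⟨s, -, hs⟩ := Finset.mem_image.1 hg
        have h := hf s.succ 0 (by simpa using hs)
        simp only [Fin.cons_succ, ← Fin.succ_castSucc, Fin.castSucc_zero, Fin.cons_zero] at h
        have : v ∈ s(w s.castSucc, w s.succ) := by rw [h]; simp
        rw [Sym2.mem_iff] at this
        exact hv (by rcases this with h | h <;> simp [h])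
      rw [Finset.card_insert_of_notMem hv, Finset.card_insert_of_notMem hg]
      omega

/-! ### Moments of products of independent centred variables -/

/-- A family of independent centred random variables, bounded by `R` almost surely and with
variances at most `v`. -/
structure IsCenteredFamily {Ω ι : Type*} [MeasurableSpace Ω] (P : Measure Ω)
    (Y : ι → Ω → ℝ) (v R : ℝ) : Prop where
  measurable : ∀ i, Measurable (Y i)
  indep : iIndepFun Y P
  bound : ∀ i, ∀ᵐ ω ∂P, |Y i ω| ≤ R
  mean : ∀ i, ∫ ω, Y i ω ∂P = 0
  second : ∀ i, ∫ ω, Y i ω ^ 2 ∂P ≤ v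

namespace IsCenteredFamily

variable {Ω ι : Type*} [MeasurableSpace Ω] {P : Measure Ω}
  {Y : ι → Ω → ℝ} {v R : ℝ}

theorem mono (hY : IsCenteredFamily P Y v R) {v' : ℝ} (hv : v ≤ v') :
    IsCenteredFamily P Y v' R :=
  ⟨hY.measurable, hY.indep, hY.bound, hY.mean, fun i => (hY.second i).trans hv⟩

theorem precomp (hY : IsCenteredFamily P Y v R) {κ : Type*} {g : κ → ι}
    (hg : Function.Injective g) : IsCenteredFamily P (fun i => Y (g i)) v R :=
  ⟨fun _ => hY.measurable _, hY.indep.precomp hg, fun _ => hY.bound _, fun _ => hY.mean _,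
    fun _ => hY.second _⟩

theorem neg (hY : IsCenteredFamily P Y v R) : IsCenteredFamily P (fun i ω => -Y i ω) v R where
  measurable i := (hY.measurable i).neg
  indep := hY.indep.comp (fun _ x => -x) fun _ => measurable_neg
  bound i := by simpa using hY.bound i
  mean i := by rw [integral_neg, hY.mean i, neg_zero]
  second i := by simpa using hY.second i

variable [IsProbabilityMeasure P]

theorem integrable_pow (hY : IsCenteredFamily P Y v R) (i : ι) (m : ℕ) :
    Integrable (fun ω => Y i ω ^ m) P := by
  refine Integrable.of_bound ((hY.measurable i).pow_const m).aestronglyMeasurable (R ^ m) ?_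
  filter_upwards [hY.bound i] with ω hω
  rw [norm_pow]
  exact pow_le_pow_left₀ (norm_nonneg _) hω m

theorem abs_integral_pow_le (hY : IsCenteredFamily P Y v R) (hR : 0 < R) (i : ι) {m : ℕ}
    (hm : 2 ≤ m) : |∫ ω, Y i ω ^ m ∂P| ≤ R ^ m * (v / R ^ 2) := by
  obtain ⟨m, rfl⟩ := Nat.exists_eq_add_of_le hm
  calc |∫ ω, Y i ω ^ (2 + m) ∂P| ≤ ∫ ω, |Y i ω ^ (2 + m)| ∂P := abs_integral_le_integral_abs
    _ ≤ ∫ ω, R ^ m * Y i ω ^ 2 ∂P := by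
        refine integral_mono_ae (hY.integrable_pow i _).abs
          ((hY.integrable_pow i 2).const_mul _) ?_
        filter_upwards [hY.bound i] with ω hω
        rw [abs_pow, add_comm, pow_add, sq_abs]
        gcongr
    _ ≤ R ^ m * v := by
        rw [integral_const_mul]
        exact mul_le_mul_of_nonneg_left (hY.second i) (by positivity)
    _ = _ := by field_simp; ring

/-- The expectation of a product of the variables vanishes if some variable occurs exactly once.
Otherwise each variable that occurs contributes the integral of a power `≥ 2`, which is small. -/
theorem abs_integral_prod_le [Fintype ι] [DecidableEq ι] (hY : IsCenteredFamily P Y v R)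
    (hR : 0 < R) (hv : 0 ≤ v) {m : ℕ} (f : Fin m → ι) :
    |∫ ω, ∏ s, Y (f s) ω ∂P| ≤
      if 2 * (Finset.univ.image f).card ≤ m then
        R ^ m * (v / R ^ 2) ^ (Finset.univ.image f).card else 0 := by
  set c : ι → ℕ := fun i => (Finset.univ.filter fun s => f s = i).card with hc
  have hprod : ∀ ω, ∏ s, Y (f s) ω = ∏ i, Y i ω ^ c i := fun ω => by
    rw [← Finset.prod_fiberwise (s := Finset.univ) f]
    refine Finset.prod_congr rfl fun i _ => ?_
    rw [hc, ← Finset.prod_const]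
    refine Finset.prod_congr rfl fun s hs => ?_
    rw [(Finset.mem_filter.1 hs).2]
  have hint : ∫ ω, ∏ s, Y (f s) ω ∂P = ∏ i, ∫ ω, Y i ω ^ c i ∂P := by
    simp_rw [hprod]
    exact hY.indep.integral_fun_prod_comp (f := fun i x => x ^ c i)
      (fun i => (hY.measurable i).aemeasurable)
      fun i => (measurable_id.pow_const _).aestronglyMeasurable
  have hnonneg : (0 : ℝ) ≤ if 2 * (Finset.univ.image f).card ≤ m then
        R ^ m * (v / R ^ 2) ^ (Finset.univ.image f).card else 0 := by
    split_ifs <;> positivity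
  by_cases h1 : ∃ i, c i = 1
  · obtain ⟨i, hi⟩ := h1
    rw [hint, Finset.prod_eq_zero (Finset.mem_univ i) (by simp [hi, hY.mean i]), abs_zero]
    exact hnonneg
  push Not at h1
  have hsum : ∑ i, c i = m := by
    have := Finset.card_eq_sum_card_fiberwise (f := f) (s := Finset.univ) (t := Finset.univ)
      (by simp)
    simpa [hc] using this.symm
  have himg : Finset.univ.image f = Finset.univ.filter fun i => 0 < c i := by
    ext i
    simp [hc, Finset.card_pos, Finset.filter_nonempty_iff]
  have hE : 2 * (Finset.univ.image f).card ≤ m := by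
    rw [himg, Finset.card_filter, Finset.mul_sum, ← hsum]
    refine Finset.sum_le_sum fun i _ => ?_
    have := h1 i
    split_ifs <;> omega
  rw [if_pos hE, hint, Finset.abs_prod]
  calc ∏ i, |∫ ω, Y i ω ^ c i ∂P|
      ≤ ∏ i, R ^ c i * (if 0 < c i then v / R ^ 2 else 1) := by
        refine Finset.prod_le_prod (fun i _ => abs_nonneg _) fun i _ => ?_
        split_ifs with h
        · exact hY.abs_integral_pow_le hR i (by have := h1 i; omega)
        · simp [Nat.eq_zero_of_not_pos h]
    _ = R ^ m * (v / R ^ 2) ^ (Finset.univ.image f).card := by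
        rw [Finset.prod_mul_distrib, Finset.prod_pow_eq_pow_sum, hsum, himg,
          ← Finset.prod_filter, Finset.prod_const]

theorem integrable_prod (hY : IsCenteredFamily P Y v R) {m : ℕ} (f : Fin m → ι) :
    Integrable (fun ω => ∏ s, Y (f s) ω) P := by
  refine Integrable.of_bound (Finset.measurable_prod _
    fun s _ => hY.measurable (f s)).aestronglyMeasurable (R ^ m) ?_
  filter_upwards [ae_all_iff.2 fun s => hY.bound (f s)] with ω hω
  rw [norm_prod]
  calc ∏ s, ‖Y (f s) ω‖ ≤ ∏ _s : Fin m, R :=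
        Finset.prod_le_prod (fun _ _ => norm_nonneg _) fun s _ => hω s
    _ = R ^ m := by simp

end IsCenteredFamily

/-! ### The trace method for symmetric matrices with independent entries -/

/-- The pairs `i < j` of vertices, which index the independent edge weights. -/
abbrev EdgeIndex (n : ℕ) : Type := {e : Fin n × Fin n // e.1 < e.2}

/-- The edge joining two distinct vertices. -/
def EdgeIndex.mk {n : ℕ} (i j : Fin n) (h : i ≠ j) : EdgeIndex n :=
  if h' : i < j then ⟨(i, j), h'⟩ else ⟨(j, i), lt_of_le_of_ne (not_lt.1 h') h.symm⟩

theorem EdgeIndex.mk_comm {n : ℕ} (i j : Fin n) (h : i ≠ j) :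
    EdgeIndex.mk i j h = EdgeIndex.mk j i h.symm := by
  unfold EdgeIndex.mk
  rcases lt_or_gt_of_ne h with h' | h'
  · rw [dif_pos h', dif_neg h'.not_gt]
  · rw [dif_pos h', dif_neg h'.not_gt]

theorem EdgeIndex.sym2_mk {n : ℕ} (i j : Fin n) (h : i ≠ j) :
    s((EdgeIndex.mk i j h).1.1, (EdgeIndex.mk i j h).1.2) = s(i, j) := by
  unfold EdgeIndex.mk
  split_ifs
  · rfl
  · exact Sym2.eq_swap

theorem EdgeIndex.sym2_eq_of_mk_eq {n : ℕ} {i j i' j' : Fin n} {h : i ≠ j} {h' : i' ≠ j'}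
    (he : EdgeIndex.mk i j h = EdgeIndex.mk i' j' h') : s(i, j) = s(i', j') := by
  rw [← EdgeIndex.sym2_mk i j h, he, EdgeIndex.sym2_mk]

/-- The symmetric matrix with zero diagonal whose off-diagonal entries are the given edge
weights. -/
def edgeMatrix {n : ℕ} (y : EdgeIndex n → ℝ) : Matrix (Fin n) (Fin n) ℝ :=
  Matrix.of fun i j => if h : i = j then 0 else y (EdgeIndex.mk i j h)

theorem edgeMatrix_self {n : ℕ} (y : EdgeIndex n → ℝ) (i : Fin n) : edgeMatrix y i i = 0 := by
  simp [edgeMatrix]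

theorem edgeMatrix_of_ne {n : ℕ} (y : EdgeIndex n → ℝ) {i j : Fin n} (h : i ≠ j) :
    edgeMatrix y i j = y (EdgeIndex.mk i j h) := by
  simp [edgeMatrix, h]

theorem edgeMatrix_isHermitian {n : ℕ} (y : EdgeIndex n → ℝ) : (edgeMatrix y).IsHermitian := by
  ext i j
  by_cases h : i = j
  · simp [h]
  · rw [Matrix.conjTranspose_apply, edgeMatrix_of_ne y h, edgeMatrix_of_ne y (Ne.symm h),
      EdgeIndex.mk_comm i j h, star_trivial]

namespace IsCenteredFamily

variable {Ω : Type*} [MeasurableSpace Ω] {P : Measure Ω} [IsProbabilityMeasure P]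
  {n : ℕ} {Y : EdgeIndex n → Ω → ℝ} {v R : ℝ}

theorem integrable_walk (hY : IsCenteredFamily P Y v R) {m : ℕ} (w : Fin (m + 1) → Fin n) :
    Integrable (fun ω => ∏ s : Fin m, edgeMatrix (fun e => Y e ω) (w s.castSucc) (w s.succ)) P := by
  by_cases hw : ∀ s : Fin m, w s.castSucc ≠ w s.succ
  · simp_rw [fun ω s => edgeMatrix_of_ne (fun e => Y e ω) (hw s)]
    exact hY.integrable_prod _
  · push Not at hw
    obtain ⟨s, hs⟩ := hw
    refine (integrable_zero Ω ℝ P).congr (Eventually.of_forall fun ω => ?_)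
    exact (Finset.prod_eq_zero (Finset.mem_univ s) (by rw [hs, edgeMatrix_self])).symm

/-- The contribution of a walk of length `2 k` to the trace, in terms of its number `V` of vertices.
With `a = 2 k / n` and `b = n v / (2 k R ^ 2) ≥ 1`, a walk with `E` edges contributes at most
`R ^ (2 k) (a b) ^ E`, and `V - 1 ≤ E ≤ k` unless it contributes nothing. -/
theorem abs_integral_walk_le (hY : IsCenteredFamily P Y v R) (hR : 0 < R) {k : ℕ}
    (hk : 1 ≤ k) (hkn : 2 * k ≤ n) (hRv : 2 * k * R ^ 2 ≤ n * v) (w : Fin (2 * k + 1) → Fin n) :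
    |∫ ω, ∏ s : Fin (2 * k), edgeMatrix (fun e => Y e ω) (w s.castSucc) (w s.succ) ∂P| ≤
      (n * v / (2 * k)) ^ k * (2 * k / n : ℝ) ^ (walkVertices w - 1) := by
  have hk0 : (0 : ℝ) < k := by exact_mod_cast hk
  have hn0 : (0 : ℝ) < n := by exact_mod_cast (by omega : 0 < n)
  have hv : 0 ≤ v := by
    by_contra h
    have : n * v < 0 := mul_neg_of_pos_of_neg hn0 (not_le.1 h)
    have : 0 < 2 * k * R ^ 2 := by positivity
    linarith
  by_cases hw : ∀ s : Fin (2 * k), w s.castSucc ≠ w s.succ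
  · simp_rw [fun ω s => edgeMatrix_of_ne (fun e => Y e ω) (hw s)]
    set f : Fin (2 * k) → EdgeIndex n := fun s => EdgeIndex.mk _ _ (hw s)
    have hV := walkVertices_le_card_image_add_one w f fun s s' h => EdgeIndex.sym2_eq_of_mk_eq h
    refine (hY.abs_integral_prod_le hR hv f).trans ?_
    set E := (Finset.univ.image f).card
    split_ifs with hE
    · set a : ℝ := 2 * k / n
      set b : ℝ := n * v / (2 * k * R ^ 2)
      have ha1 : a ≤ 1 := by
        rw [div_le_one hn0]
        exact_mod_cast hkn
      have hb1 : 1 ≤ b := by rwa [one_le_div (by positivity)]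
      have hab : v / R ^ 2 = b * a := by
        simp only [a, b]; field_simp
      have hEk : E ≤ k := by omega
      calc R ^ (2 * k) * (v / R ^ 2) ^ E = R ^ (2 * k) * (b ^ E * a ^ E) := by
            rw [hab, mul_pow]
        _ ≤ R ^ (2 * k) * (b ^ k * a ^ (walkVertices w - 1)) := by
            gcongr ?_ * (?_ * ?_)
            · exact pow_le_pow_right₀ hb1 hEk
            · exact pow_le_pow_of_le_one (by positivity) ha1 (by omega)
        _ = _ := by
            rw [← mul_assoc, pow_mul, ← mul_pow]
            congr 2
            simp only [b]; field_simp
    · positivity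
  · push Not at hw
    obtain ⟨s, hs⟩ := hw
    have : ∀ ω, ∏ s : Fin (2 * k), edgeMatrix (fun e => Y e ω) (w s.castSucc) (w s.succ) = 0 :=
      fun ω => Finset.prod_eq_zero (Finset.mem_univ s) (by rw [hs, edgeMatrix_self])
    simp_rw [this]
    simp only [integral_zero, abs_zero]
    positivity

theorem integrable_trace_pow (hY : IsCenteredFamily P Y v R) (m : ℕ) :
    Integrable (fun ω => (edgeMatrix (fun e => Y e ω) ^ m).trace) P := by
  simp_rw [Matrix.trace_pow_eq_sum_walks]
  refine integrable_finsetSum _ fun w _ => ?_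
  split_ifs
  · exact hY.integrable_walk w
  · exact integrable_zero _ _ _

/-- The trace method. The sum over all walks, not only the closed ones, is bounded by
`sum_pow_walkVertices_le` with `a = 2 k / n`, for which the two terms of `n a + 2 k` balance. -/
theorem integral_trace_pow_le (hY : IsCenteredFamily P Y v R) (hR : 0 < R) {k : ℕ}
    (hk : 1 ≤ k) (hkn : 2 * k ≤ n) (hRv : 2 * k * R ^ 2 ≤ n * v) :
    ∫ ω, (edgeMatrix (fun e => Y e ω) ^ (2 * k)).trace ∂P ≤ n * (8 * n * k * v) ^ k := by
  have hk0 : (0 : ℝ) < k := by exact_mod_cast hk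
  have hn0 : (0 : ℝ) < n := by exact_mod_cast (by omega : 0 < n)
  have hnv : 0 ≤ n * v := le_trans (by positivity) hRv
  simp_rw [Matrix.trace_pow_eq_sum_walks]
  rw [integral_finsetSum]
  swap
  · intro w _
    split_ifs
    · exact hY.integrable_walk w
    · exact integrable_zero _ _ _
  set a : ℝ := 2 * k / n with ha
  have hpos : ∀ w : Fin (2 * k + 1) → Fin n, 1 ≤ walkVertices w := fun w =>
    Finset.card_pos.2 ⟨w 0, by simp⟩
  calc _ ≤ ∑ w : Fin (2 * k + 1) → Fin n,
        (n * v / (2 * k)) ^ k * a⁻¹ * a ^ walkVertices w := by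
        refine Finset.sum_le_sum fun w _ => ?_
        have h := hY.abs_integral_walk_le hR hk hkn hRv w
        have h' : (n * v / (2 * k)) ^ k * a⁻¹ * a ^ walkVertices w =
            (n * v / (2 * k)) ^ k * a ^ (walkVertices w - 1) := by
          have : 0 < a := by positivity
          rw [← Nat.sub_add_cancel (hpos w), pow_succ, Nat.add_sub_cancel]
          field_simp
        rw [h']
        split_ifs
        · exact (le_abs_self _).trans h
        · rw [integral_zero]
          exact (abs_nonneg _).trans h
    _ ≤ (n * v / (2 * k)) ^ k * a⁻¹ * ((n * a) * (n * a + (2 * k : ℕ)) ^ (2 * k)) := by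
        rw [← Finset.mul_sum]
        gcongr
        simpa using sum_pow_walkVertices_le (α := Fin n) (a := a) (by positivity) (2 * k)
    _ = n * ((n * v / (2 * k)) * (4 * k) ^ 2) ^ k := by
        have hna : n * a = 2 * k := by rw [ha]; field_simp
        have hia : a⁻¹ * (2 * k) = n := by rw [ha]; field_simp
        rw [hna, mul_pow, ← pow_mul, mul_assoc, ← mul_assoc a⁻¹, hia]
        push_cast
        ring
    _ = _ := by
        congr 2
        field_simp
        ring

end IsCenteredFamily

/-! ### Quadratic forms and eigenvalues -/

theorem Matrix.IsHermitian.eigenvalues₀_le_of_quadForm_le {n : ℕ} {A : Matrix (Fin n) (Fin n) ℝ}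
    (hA : A.IsHermitian) {Λ : ℝ} (h : ∀ x : Fin n → ℝ, x ⬝ᵥ A.mulVec x ≤ Λ * (x ⬝ᵥ x))
    (i : Fin (Fintype.card (Fin n))) : hA.eigenvalues₀ i ≤ Λ := by
  obtain ⟨j, hj⟩ : ∃ j, hA.eigenvalues j = hA.eigenvalues₀ i :=
    ⟨Fintype.equivOfCardEq (Fintype.card_fin _) i, by
      simp [Matrix.IsHermitian.eigenvalues]⟩
  rw [← hj, hA.eigenvalues_eq j]
  have h1 : (⇑(hA.eigenvectorBasis j) : Fin n → ℝ) ⬝ᵥ ⇑(hA.eigenvectorBasis j) = 1 := by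
    have := hA.eigenvectorBasis.orthonormal.1 j
    have h2 := EuclideanSpace.real_norm_sq_eq (hA.eigenvectorBasis j)
    rw [this] at h2
    simp only [dotProduct, ← pow_two]
    rw [← h2, one_pow]
  have := h (⇑(hA.eigenvectorBasis j))
  rw [h1, mul_one] at this
  simpa using this

theorem Matrix.trace_conjStarAlgAut {n : ℕ} (U : Matrix.unitaryGroup (Fin n) ℝ)
    (D : Matrix (Fin n) (Fin n) ℝ) : (Unitary.conjStarAlgAut ℝ _ U D).trace = D.trace := by
  rw [Unitary.conjStarAlgAut_apply, Matrix.trace_mul_cycle]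
  simp

/-- An even trace power bounds the quadratic form from below: `t + A` has no negative eigenvalue,
since otherwise the corresponding eigenvalue of `A` would be smaller than `-t`. -/
theorem Matrix.IsHermitian.neg_quadForm_le_of_trace_pow_le {n : ℕ}
    {A : Matrix (Fin n) (Fin n) ℝ} (hA : A.IsHermitian) {t : ℝ} (ht : 0 ≤ t) {k : ℕ} (hk : 1 ≤ k)
    (h : (A ^ (2 * k)).trace ≤ t ^ (2 * k)) (x : Fin n → ℝ) :
    -(x ⬝ᵥ A.mulVec x) ≤ t * (x ⬝ᵥ x) := by
  set M : Matrix (Fin n) (Fin n) ℝ := t • 1 + A with hMdef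
  have hM : M.IsHermitian := by
    rw [Matrix.IsHermitian, hMdef, Matrix.conjTranspose_add, hA.eq]
    simp
  have hAM : A = Unitary.conjStarAlgAut ℝ _ hM.eigenvectorUnitary
      (Matrix.diagonal fun i => hM.eigenvalues i - t) := by
    have h1 : (Matrix.diagonal fun i => hM.eigenvalues i - t) =
        Matrix.diagonal ((RCLike.ofReal : ℝ → ℝ) ∘ hM.eigenvalues) - t • 1 := by
      ext i j
      by_cases hij : i = j <;> simp [hij]
    rw [h1, map_sub, ← hM.spectral_theorem, map_smul, map_one, hMdef]
    simp
  have htr : (A ^ (2 * k)).trace = ∑ i, (hM.eigenvalues i - t) ^ (2 * k) := by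
    rw [hAM, ← map_pow, Matrix.trace_conjStarAlgAut, Matrix.diagonal_pow, Matrix.trace_diagonal]
    simp
  have hpos : ∀ i, 0 ≤ hM.eigenvalues i := by
    intro i
    by_contra hneg
    push Not at hneg
    have h2 : (hM.eigenvalues i - t) ^ (2 * k) ≤ t ^ (2 * k) := by
      refine le_trans ?_ (htr ▸ h)
      exact Finset.single_le_sum (f := fun i => (hM.eigenvalues i - t) ^ (2 * k))
        (fun j _ => (even_two_mul k).pow_nonneg _) (Finset.mem_univ i)
    have h3 : t ^ (2 * k) < (hM.eigenvalues i - t) ^ (2 * k) := by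
      rw [← (even_two_mul k).neg_pow (hM.eigenvalues i - t)]
      exact pow_lt_pow_left₀ (by linarith) ht (by omega)
    linarith
  have hx := (hM.posSemidef_iff_eigenvalues_nonneg.2 hpos).dotProduct_mulVec_nonneg x
  rw [hMdef, Matrix.add_mulVec, Matrix.smul_mulVec, Matrix.one_mulVec, dotProduct_add,
    dotProduct_smul] at hx
  simp only [star_trivial, smul_eq_mul] at hx
  linarith

namespace WeightedGraph

variable {n : ℕ} (G : WeightedGraph n)

theorem totalWeight_eq_sum_edgeIndex :
    G.totalWeight = ∑ e : EdgeIndex n, G.weight e.1.1 e.1.2 := by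
  unfold totalWeight
  rw [← Finset.sum_subtype (Finset.univ.filter fun e : Fin n × Fin n => e.1 < e.2) (by simp)
    fun e : Fin n × Fin n => G.weight e.1 e.2, Finset.sum_filter, Fintype.sum_prod_type]
  simp_rw [Finset.sum_filter]

theorem weight_eq_edgeIndex {i j : Fin n} (h : i ≠ j) :
    G.weight i j = G.weight (EdgeIndex.mk i j h).1.1 (EdgeIndex.mk i j h).1.2 := by
  unfold EdgeIndex.mk
  split_ifs
  · rfl
  · exact G.weight_symm i j

theorem laplacian_quadForm (x : Fin n → ℝ) :
    x ⬝ᵥ G.laplacian.mulVec x =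
      ∑ i, (∑ j, G.weight i j) * x i ^ 2 - ∑ i, ∑ j, G.weight i j * (x i * x j) := by
  have hL : G.laplacian =
      Matrix.diagonal (fun i => ∑ j, G.weight i j) - Matrix.of G.weight := by
    ext i j
    by_cases h : i = j
    · subst h
      simp [laplacian, G.weight_self, Finset.sum_filter_of_ne (s := Finset.univ)
        (f := G.weight i) (p := fun j => j ≠ i)
        (fun j _ hj hji => hj (by rw [hji, G.weight_self]))]
    · simp [laplacian, h]
  rw [hL, Matrix.sub_mulVec, dotProduct_sub]
  congr 1
  · simp only [dotProduct, Matrix.mulVec_diagonal]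
    exact Finset.sum_congr rfl fun i _ => by ring
  · simp only [dotProduct, Matrix.mulVec, Matrix.of_apply, Finset.mul_sum]
    exact Finset.sum_congr rfl fun i _ => Finset.sum_congr rfl fun j _ => by ring

/-- If the weights are `μ + y`, up to an error `β` in each entry, then the constant part contributes
at most `n μ` to the largest Laplacian eigenvalue, and `y` contributes through its row sums and
through its quadratic form. -/
theorem eigenvalues₀_laplacian_le {μ β t : ℝ} (y : EdgeIndex n → ℝ) (hμ : 0 ≤ μ) (hβ : 0 ≤ β)
    (hw : ∀ e : EdgeIndex n, |G.weight e.1.1 e.1.2 - μ - y e| ≤ β)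
    (hrow : ∀ i, ∑ j, edgeMatrix y i j ≤ t)
    (hquad : ∀ x : Fin n → ℝ, -(x ⬝ᵥ (edgeMatrix y).mulVec x) ≤ t * (x ⬝ᵥ x))
    (i : Fin (Fintype.card (Fin n))) :
    G.laplacian_isHermitian.eigenvalues₀ i ≤ n * μ + 2 * t + 2 * (n * β) := by
  refine G.laplacian_isHermitian.eigenvalues₀_le_of_quadForm_le (fun x => ?_) i
  obtain ⟨b, hb, hb0, hwb⟩ : ∃ b : Fin n → Fin n → ℝ, (∀ i j, i ≠ j → |b i j| ≤ β) ∧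
      (∀ i, b i i = 0) ∧
      ∀ i j, G.weight i j = (if i = j then 0 else μ) + edgeMatrix y i j + b i j := by
    refine ⟨fun i j => G.weight i j - (if i = j then 0 else μ) - edgeMatrix y i j, ?_, ?_, ?_⟩
    · intro i j h
      simp only [if_neg h, edgeMatrix_of_ne y h]
      rw [G.weight_eq_edgeIndex h]
      exact hw _
    · intro i
      simp [G.weight_self, edgeMatrix_self]
    · intro i j
      ring
  have hrows : ∀ i, ∑ j, G.weight i j ≤ (n - 1) * μ + t + ∑ j, b i j := by
    intro i
    simp_rw [hwb, Finset.sum_add_distrib]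
    have : ∑ j, (if i = j then 0 else μ) = (n - 1) * μ := by
      rw [← Finset.sum_congr rfl fun j _ => show μ - (if i = j then μ else 0) = _ by
        split_ifs <;> ring, Finset.sum_sub_distrib, Finset.sum_ite_eq]
      simp
      ring
    rw [this]
    linarith [hrow i]
  have hmu : ∑ i, ∑ j, (if i = j then 0 else μ) * (x i * x j) =
      μ * (∑ i, x i) ^ 2 - μ * ∑ i, x i ^ 2 := by
    rw [pow_two, Finset.sum_mul_sum, Finset.mul_sum, Finset.mul_sum, ← Finset.sum_sub_distrib]
    refine Finset.sum_congr rfl fun i _ => ?_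
    rw [← Finset.sum_congr rfl fun j _ =>
      show μ * (x i * x j) - (if i = j then μ * (x i * x j) else 0) = _ by split_ifs <;> ring,
      Finset.sum_sub_distrib, Finset.sum_ite_eq, Finset.mul_sum]
    simp only [Finset.mem_univ, if_true]
    ring
  have hy : ∑ i, ∑ j, edgeMatrix y i j * (x i * x j) = x ⬝ᵥ (edgeMatrix y).mulVec x := by
    simp only [dotProduct, Matrix.mulVec, Finset.mul_sum]
    exact Finset.sum_congr rfl fun i _ => Finset.sum_congr rfl fun j _ => by ring
  -- The error matrix `b`: its row sums and its quadratic form together.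
  have hbq : ∑ i, ∑ j, b i j * (x i ^ 2 - x i * x j) ≤ 2 * (n * β) * ∑ i, x i ^ 2 := by
    have hterm : ∀ i j, b i j * (x i ^ 2 - x i * x j) ≤ β * (3 / 2 * x i ^ 2 + 1 / 2 * x j ^ 2) := by
      intro i j
      have hbij : |b i j| ≤ β := by
        by_cases h : i = j
        · rwa [h, hb0, abs_zero]
        · exact hb i j h
      have h1 : |x i ^ 2 - x i * x j| ≤ 3 / 2 * x i ^ 2 + 1 / 2 * x j ^ 2 := by
        rw [abs_le]
        constructor <;> nlinarith [sq_nonneg (x i + x j), sq_nonneg (x i - x j)]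
      calc _ ≤ |b i j * (x i ^ 2 - x i * x j)| := le_abs_self _
        _ = |b i j| * |x i ^ 2 - x i * x j| := abs_mul _ _
        _ ≤ _ := mul_le_mul hbij h1 (abs_nonneg _) hβ
    refine (Finset.sum_le_sum fun i _ => Finset.sum_le_sum fun j _ => hterm i j).trans_eq ?_
    simp only [← Finset.mul_sum, Finset.sum_add_distrib, Finset.sum_const, Finset.card_univ,
      Fintype.card_fin, nsmul_eq_mul]
    ring
  have hsq : x ⬝ᵥ x = ∑ i, x i ^ 2 := by simp only [dotProduct, pow_two]
  have hdiag : ∑ i, (∑ j, G.weight i j) * x i ^ 2 ≤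
      ((n - 1) * μ + t) * ∑ i, x i ^ 2 + ∑ i, ∑ j, b i j * x i ^ 2 := by
    rw [Finset.mul_sum, ← Finset.sum_add_distrib]
    refine Finset.sum_le_sum fun i _ => ?_
    rw [← Finset.sum_mul, ← add_mul]
    exact mul_le_mul_of_nonneg_right (hrows i) (sq_nonneg _)
  have hoff : ∑ i, ∑ j, G.weight i j * (x i * x j) =
      μ * (∑ i, x i) ^ 2 - μ * ∑ i, x i ^ 2 + x ⬝ᵥ (edgeMatrix y).mulVec x +
        ∑ i, ∑ j, b i j * (x i * x j) := by
    rw [← hmu, ← hy]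
    simp_rw [hwb, add_mul, Finset.sum_add_distrib]
  have hbq' : ∑ i, ∑ j, b i j * (x i ^ 2 - x i * x j) =
      ∑ i, ∑ j, b i j * x i ^ 2 - ∑ i, ∑ j, b i j * (x i * x j) := by
    simp_rw [mul_sub, Finset.sum_sub_distrib]
  have hq := hquad x
  rw [laplacian_quadForm, hoff, hsq]
  rw [hsq] at hq
  nlinarith [mul_nonneg hμ (sq_nonneg (∑ i, x i))]

/-- A weighted graph with many edges and no large Laplacian eigenvalue satisfies Brouwer's
inequality, because `k Λ ≤ Λ ^ 2 / 2 + k ^ 2 / 2`. -/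
theorem satisfiesBrouwer_of_eigenvalues₀_le {Λ : ℝ} (hΛ : 0 ≤ Λ)
    (h : ∀ i, G.laplacian_isHermitian.eigenvalues₀ i ≤ Λ) (he : Λ ^ 2 / 2 ≤ G.totalWeight) :
    G.SatisfiesBrouwer := by
  intro k _ hkn
  have h1 : G.sumLargest k ≤ k * Λ := by
    unfold sumLargest
    refine (Finset.sum_le_card_nsmul _ _ Λ fun i _ => h i).trans ?_
    rw [nsmul_eq_mul]
    gcongr
    calc _ = ((Finset.univ.filter fun i : Fin (Fintype.card (Fin n)) => (i : ℕ) < k).map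
            Fin.valEmbedding).card := (Finset.card_map _).symm
      _ ≤ (Finset.range k).card := by
          refine Finset.card_le_card fun i hi => ?_
          simp only [Finset.mem_map, Finset.mem_filter, Finset.mem_univ, true_and] at hi
          obtain ⟨j, hj, rfl⟩ := hi
          simpa using hj
      _ = k := Finset.card_range k
  have h2 : ((k + 1).choose 2 : ℝ) = (k + 1) * k / 2 := by
    rw [Nat.cast_choose_two]
    push_cast
    ring
  have h3 : (0 : ℝ) ≤ k := k.cast_nonneg
  rw [h2]
  nlinarith [sq_nonneg (Λ - k)]

end WeightedGraph

/-! ### Sums of independent bounded centred variables -/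

namespace IsCenteredFamily

variable {Ω ι : Type*} [MeasurableSpace Ω] {P : Measure Ω} {Y : ι → Ω → ℝ} {v R : ℝ}

theorem integral_sum_pow_mul (hY : IsCenteredFamily P Y v R) {s : Finset ι} {i : ι} (hi : i ∉ s)
    (a b : ℕ) : ∫ ω, (∑ j ∈ s, Y j ω) ^ a * Y i ω ^ b ∂P =
      (∫ ω, (∑ j ∈ s, Y j ω) ^ a ∂P) * ∫ ω, Y i ω ^ b ∂P := by
  have hind : IndepFun (fun ω => ∑ j ∈ s, Y j ω) (Y i) P := by
    have := hY.indep.indepFun_finsetSum_of_notMem hY.measurable hi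
    convert this using 1
    ext ω
    simp
  exact hind.integral_fun_comp_mul_comp (f := fun x => x ^ a) (g := fun x => x ^ b)
    (Finset.measurable_sum _ fun i _ => hY.measurable i).aemeasurable
    (hY.measurable i).aemeasurable (measurable_id.pow_const _).aestronglyMeasurable
    (measurable_id.pow_const _).aestronglyMeasurable

variable [IsProbabilityMeasure P]

theorem integrable_exp (hY : IsCenteredFamily P Y v R) (i : ι) (h : ℝ) :
    Integrable (fun ω => Real.exp (h * Y i ω)) P := by
  refine Integrable.of_bound ((hY.measurable i).const_mul h).exp.aestronglyMeasurable
    (Real.exp (|h| * R)) ?_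
  filter_upwards [hY.bound i] with ω hω
  rw [Real.norm_eq_abs, Real.abs_exp, Real.exp_le_exp]
  calc h * Y i ω ≤ |h * Y i ω| := le_abs_self _
    _ = |h| * |Y i ω| := abs_mul _ _
    _ ≤ _ := by gcongr

theorem mgf_le (hY : IsCenteredFamily P Y v R) {h : ℝ} (h0 : 0 ≤ h) (hR : h * R ≤ 1) (i : ι) :
    mgf (Y i) P h ≤ Real.exp (h ^ 2 * v) := by
  have hint : Integrable (fun ω => Y i ω) P := by simpa using hY.integrable_pow i 1
  calc mgf (Y i) P h ≤ ∫ ω, (1 + h * Y i ω + h ^ 2 * Y i ω ^ 2) ∂P := by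
        refine integral_mono_ae (hY.integrable_exp i h)
          (((integrable_const _).fun_add (hint.const_mul _)).fun_add
            ((hY.integrable_pow i 2).const_mul _)) ?_
        filter_upwards [hY.bound i] with ω hω
        have h1 : |h * Y i ω| ≤ 1 := by
          rw [abs_mul, abs_of_nonneg h0]
          exact (mul_le_mul_of_nonneg_left hω h0).trans hR
        have := (abs_le.1 (Real.abs_exp_sub_one_sub_id_le h1)).2
        rw [mul_pow] at this
        linarith
    _ = 1 + h ^ 2 * ∫ ω, Y i ω ^ 2 ∂P := by
        rw [integral_add ((integrable_const _).fun_add (hint.const_mul _))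
          ((hY.integrable_pow i 2).const_mul _), integral_add (integrable_const _)
          (hint.const_mul _), integral_const_mul, integral_const_mul, hY.mean i]
        simp
    _ ≤ 1 + h ^ 2 * v := by gcongr; exact hY.second i
    _ ≤ _ := by rw [add_comm]; exact Real.add_one_le_exp _

/-- Bernstein's inequality, with the parameter `h` of the exponential moment left free. -/
theorem measureReal_le_sum_le [Fintype ι] (hY : IsCenteredFamily P Y v R) {h : ℝ} (h0 : 0 ≤ h)
    (hR : h * R ≤ 1) (t : ℝ) :
    P.real {ω | t ≤ ∑ i, Y i ω} ≤ Real.exp (-h * t + Fintype.card ι * (h ^ 2 * v)) := by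
  have hint : Integrable (fun ω => Real.exp (h * (∑ i, Y i) ω)) P :=
    hY.indep.integrable_exp_mul_sum hY.measurable fun i _ => hY.integrable_exp i h
  have := measure_ge_le_exp_mul_mgf (μ := P) (X := ∑ i, Y i) t h0 hint
  simp only [Finset.sum_apply] at this
  refine this.trans ?_
  rw [hY.indep.mgf_sum hY.measurable, Real.exp_add]
  gcongr
  calc ∏ i, mgf (Y i) P h ≤ ∏ _i : ι, Real.exp (h ^ 2 * v) :=
        Finset.prod_le_prod (fun i _ => mgf_nonneg) fun i _ => hY.mgf_le h0 hR i
    _ = _ := by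
      rw [Finset.prod_const, Finset.card_univ, ← Real.exp_nat_mul]

theorem integrable_sum_pow (hY : IsCenteredFamily P Y v R) (s : Finset ι) (m : ℕ) :
    Integrable (fun ω => (∑ i ∈ s, Y i ω) ^ m) P := by
  refine Integrable.of_bound ((Finset.measurable_sum _
    fun i _ => hY.measurable i).pow_const m).aestronglyMeasurable ((s.card * R) ^ m) ?_
  have : ∀ᵐ ω ∂P, ∀ i : s, |Y i ω| ≤ R := ae_all_iff.2 fun i => hY.bound i
  filter_upwards [this] with ω hω
  rw [norm_pow]
  refine pow_le_pow_left₀ (norm_nonneg _) ?_ m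
  refine (norm_sum_le _ _).trans ?_
  rw [← nsmul_eq_mul]
  exact Finset.sum_le_card_nsmul _ _ _ fun i hi => hω ⟨i, hi⟩

theorem integrable_sum_pow_mul (hY : IsCenteredFamily P Y v R) (s : Finset ι) (i : ι) (a b : ℕ) :
    Integrable (fun ω => (∑ j ∈ s, Y j ω) ^ a * Y i ω ^ b) P := by
  refine (hY.integrable_sum_pow s a).mul_bdd (c := R ^ b)
    ((hY.measurable i).pow_const b).aestronglyMeasurable ?_
  filter_upwards [hY.bound i] with ω hω
  rw [norm_pow]
  exact pow_le_pow_left₀ (norm_nonneg _) hω b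

theorem integral_sum (hY : IsCenteredFamily P Y v R) (s : Finset ι) :
    ∫ ω, ∑ i ∈ s, Y i ω ∂P = 0 := by
  rw [integral_finsetSum]
  · exact Finset.sum_eq_zero fun i _ => hY.mean i
  · intro i _
    simpa using hY.integrable_pow i 1

theorem integral_sum_sq (hY : IsCenteredFamily P Y v R) (h2 : ∀ i, ∫ ω, Y i ω ^ 2 ∂P = v)
    (s : Finset ι) : ∫ ω, (∑ i ∈ s, Y i ω) ^ 2 ∂P = s.card * v := by
  classical
  induction s using Finset.induction_on with
  | empty => simp
  | insert i s hi ih =>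
    have hexp : ∀ ω, (∑ j ∈ insert i s, Y j ω) ^ 2 = (∑ j ∈ s, Y j ω) ^ 2 * Y i ω ^ 0 +
        2 * ((∑ j ∈ s, Y j ω) ^ 1 * Y i ω ^ 1) + (∑ j ∈ s, Y j ω) ^ 0 * Y i ω ^ 2 := fun ω => by
      rw [Finset.sum_insert hi]
      ring
    have hI := hY.integrable_sum_pow_mul s i
    simp_rw [hexp]
    rw [integral_add ((hI 2 0).fun_add ((hI 1 1).const_mul 2)) (hI 0 2),
      integral_add (hI 2 0) ((hI 1 1).const_mul 2), integral_const_mul]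
    simp_rw [hY.integral_sum_pow_mul hi, pow_one, hY.mean, ih, h2, Finset.card_insert_of_notMem hi]
    simp
    ring

theorem integral_sum_pow_four_le (hY : IsCenteredFamily P Y v R)
    (h2 : ∀ i, ∫ ω, Y i ω ^ 2 ∂P = v) {q : ℝ} (h4 : ∀ i, ∫ ω, Y i ω ^ 4 ∂P ≤ q)
    (s : Finset ι) :
    ∫ ω, (∑ i ∈ s, Y i ω) ^ 4 ∂P ≤ s.card * q + 3 * s.card ^ 2 * v ^ 2 := by
  classical
  induction s using Finset.induction_on with
  | empty => simp
  | insert i s hi ih =>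
    have hexp : ∀ ω, (∑ j ∈ insert i s, Y j ω) ^ 4 = (∑ j ∈ s, Y j ω) ^ 4 * Y i ω ^ 0 +
        4 * ((∑ j ∈ s, Y j ω) ^ 3 * Y i ω ^ 1) + 6 * ((∑ j ∈ s, Y j ω) ^ 2 * Y i ω ^ 2) +
        4 * ((∑ j ∈ s, Y j ω) ^ 1 * Y i ω ^ 3) + (∑ j ∈ s, Y j ω) ^ 0 * Y i ω ^ 4 := fun ω => by
      rw [Finset.sum_insert hi]
      ring
    have hI := hY.integrable_sum_pow_mul s i
    have h31 := (hI 3 1).const_mul 4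
    have h22 := (hI 2 2).const_mul 6
    have h13 := (hI 1 3).const_mul 4
    simp_rw [hexp]
    rw [integral_add ((((hI 4 0).fun_add h31).fun_add h22).fun_add h13) (hI 0 4),
      integral_add (((hI 4 0).fun_add h31).fun_add h22) h13, integral_add ((hI 4 0).fun_add h31) h22,
      integral_add (hI 4 0) h31, integral_const_mul, integral_const_mul, integral_const_mul]
    simp_rw [hY.integral_sum_pow_mul hi, pow_one, hY.mean, hY.integral_sum,
      hY.integral_sum_sq h2, h2, Finset.card_insert_of_notMem hi]
    have := h4 i
    simp
    nlinarith [sq_nonneg v]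

end IsCenteredFamily

/-- A one-sided Paley–Zygmund inequality: a centred variable with controlled fourth moment is
nonnegative with probability bounded below. It is obtained by integrating the polynomial
`Q x + x ^ 2 - x ^ 4 / (2 Q)`, which is nonpositive for `x ≤ 0` and at most `6 Q ^ 2` for
`0 ≤ x`. -/
theorem le_measureReal_nonneg_of_moments {Ω : Type*} [MeasurableSpace Ω] {P : Measure Ω}
    [IsProbabilityMeasure P] {S : Ω → ℝ} {V Q : ℝ} (hV : 0 < V) (hQ : 1 ≤ Q) (hS : Measurable S)
    (hi : ∀ m : ℕ, Integrable (fun ω => S ω ^ m) P) (h1 : ∫ ω, S ω ∂P = 0)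
    (h2 : ∫ ω, S ω ^ 2 ∂P = V) (h4 : ∫ ω, S ω ^ 4 ∂P ≤ Q * V ^ 2) :
    1 / (12 * Q ^ 2) ≤ P.real {ω | 0 ≤ S ω} := by
  have hQ0 : 0 < Q := by linarith
  set r := Real.sqrt V with hr
  have hr0 : 0 < r := Real.sqrt_pos.2 hV
  have hr2 : r ^ 2 = V := Real.sq_sqrt hV.le
  have hmeas : MeasurableSet {ω | 0 ≤ S ω} := measurableSet_le measurable_const hS
  have key : ∀ x : ℝ, (Q * x + x ^ 2 - x ^ 4 / (2 * Q)) / (6 * Q ^ 2) ≤ if 0 ≤ x then 1 else 0 := by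
    intro x
    rw [div_le_iff₀ (by positivity)]
    have hx4 : x ^ 4 / (2 * Q) * (2 * Q) = x ^ 4 := by field_simp
    set z := x ^ 4 / (2 * Q)
    have hz : 0 ≤ z := by positivity
    split_ifs with hx
    · rcases le_total x (2 * Q) with h | h
      · nlinarith
      · have h3 : 2 * Q * x ^ 2 ≤ z := by
          have : (2 * Q) * (2 * Q * x ^ 2) ≤ x ^ 4 := by
            have : (2 * Q) ^ 2 ≤ x ^ 2 := by gcongr
            nlinarith [sq_nonneg x]
          nlinarith
        nlinarith [sq_nonneg x]
    · push Not at hx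
      obtain ⟨y, hy, rfl⟩ : ∃ y, 0 < y ∧ x = -y := ⟨-x, by linarith, by ring⟩
      -- Dividing by `y`, the claim is `y ≤ Q + y ^ 3 / (2 Q)`.
      have h3 : y ^ 2 ≤ Q * y + z := by
        rcases le_total y Q with h | h
        · nlinarith
        · have : Q ^ 2 ≤ y ^ 2 := by gcongr
          have hz1 : Q * y ^ 2 ≤ 2 * z := by
            have : Q * (Q * y ^ 2) ≤ y ^ 4 := by nlinarith [sq_nonneg y]
            have : Q * (Q * y ^ 2) ≤ Q * (2 * z) := by nlinarith
            exact le_of_mul_le_mul_left this hQ0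
          nlinarith [sq_nonneg (y - 1), sq_nonneg y]
      nlinarith
  have e : ∀ ω, (Q * (S ω / r) + (S ω / r) ^ 2 - (S ω / r) ^ 4 / (2 * Q)) / (6 * Q ^ 2) =
      (Q / r / (6 * Q ^ 2)) * S ω ^ 1 + (1 / V / (6 * Q ^ 2)) * S ω ^ 2 -
        (1 / V ^ 2 / (2 * Q) / (6 * Q ^ 2)) * S ω ^ 4 := fun ω => by
    rw [← hr2]
    field_simp
  have hint : ∫ ω, (Q * (S ω / r) + (S ω / r) ^ 2 - (S ω / r) ^ 4 / (2 * Q)) / (6 * Q ^ 2) ∂P =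
      (1 - (∫ ω, S ω ^ 4 ∂P) / V ^ 2 / (2 * Q)) / (6 * Q ^ 2) := by
    simp_rw [e]
    rw [integral_sub (((hi 1).const_mul _).fun_add ((hi 2).const_mul _)) ((hi 4).const_mul _),
      integral_add ((hi 1).const_mul _) ((hi 2).const_mul _), integral_const_mul,
      integral_const_mul, integral_const_mul, h2]
    simp_rw [pow_one, h1]
    field_simp
    ring
  have hle : ∫ ω, (Q * (S ω / r) + (S ω / r) ^ 2 - (S ω / r) ^ 4 / (2 * Q)) / (6 * Q ^ 2) ∂P ≤
      P.real {ω | 0 ≤ S ω} := by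
    rw [← integral_indicator_one hmeas]
    refine integral_mono ?_ ((integrable_const (1 : ℝ)).indicator hmeas) fun ω => ?_
    · simp_rw [e]
      exact (((hi 1).const_mul _).fun_add ((hi 2).const_mul _)).sub ((hi 4).const_mul _)
    · refine (key _).trans_eq ?_
      simp only [Set.indicator_apply, Set.mem_ofPred_eq, Pi.one_apply]
      simp only [le_div_iff₀ hr0, zero_mul]
  refine le_trans ?_ hle
  rw [hint, div_le_div_iff₀ (by positivity) (by positivity)]
  have : (∫ ω, S ω ^ 4 ∂P) / V ^ 2 / (2 * Q) ≤ 1 / 2 := by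
    rw [div_div, div_le_iff₀ (by positivity)]
    nlinarith
  nlinarith [sq_nonneg Q]

/-! ### Tail bound for the random part of the Laplacian -/

/-- The row sums of the matrix of edge weights `y` are at most `t` and its quadratic form is at
least `-t`. Then the quadratic form of the Laplacian with weights `y` is at most `2 t`. -/
def IsSpectrallyBounded {n : ℕ} (y : EdgeIndex n → ℝ) (t : ℝ) : Prop :=
  (∀ i, ∑ j, edgeMatrix y i j ≤ t) ∧
    ∀ x : Fin n → ℝ, -(x ⬝ᵥ (edgeMatrix y).mulVec x) ≤ t * (x ⬝ᵥ x)

theorem exp_one_sq_le : Real.exp 1 ^ 2 ≤ 7.39 := by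
  have h := Real.exp_one_lt_d9
  have h0 := Real.exp_pos 1
  nlinarith

theorem Real.exp_neg_two_mul_natCast (k : ℕ) :
    Real.exp (-2 * k) = ((Real.exp 1 ^ 2) ^ k)⁻¹ := by
  rw [← pow_mul, ← Real.exp_nat_mul, ← Real.exp_neg]
  push_cast
  ring_nf

theorem Matrix.IsHermitian.trace_pow_two_mul_nonneg {n : ℕ} {A : Matrix (Fin n) (Fin n) ℝ}
    (hA : A.IsHermitian) (k : ℕ) : 0 ≤ (A ^ (2 * k)).trace := by
  have h : A ^ (2 * k) = (A ^ k).conjTranspose * A ^ k := by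
    rw [Matrix.conjTranspose_pow, hA.eq, two_mul, pow_add]
  rw [h]
  exact (Matrix.posSemidef_conjTranspose_mul_self _).trace_nonneg

namespace IsCenteredFamily

variable {Ω : Type*} [MeasurableSpace Ω] {P : Measure Ω} [IsProbabilityMeasure P]
  {n : ℕ} {Y : EdgeIndex n → Ω → ℝ} {v R t : ℝ} {k : ℕ}

theorem measureReal_row_sum_ge_le (hY : IsCenteredFamily P Y v R) (hR : 0 < R) (hv : 0 ≤ v)
    (hk : 1 ≤ k) (hvt : 60 * k * n * v ≤ t ^ 2) (hRt : 11 * k * R ≤ t) (i : Fin n) :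
    P.real {ω | t ≤ ∑ j, edgeMatrix (fun e => Y e ω) i j} ≤ Real.exp (-2 * k) := by
  have hk0 : (0 : ℝ) < k := by exact_mod_cast hk
  have ht : 0 < t := lt_of_lt_of_le (by positivity) hRt
  have hsum : ∀ ω, ∑ j, edgeMatrix (fun e => Y e ω) i j =
      ∑ j : {j // i ≠ j}, Y (EdgeIndex.mk i j j.2) ω := fun ω => by
    rw [← Finset.sum_filter_of_ne (s := Finset.univ) (p := fun j => i ≠ j)
      (fun j _ hj hij => hj (by rw [hij, edgeMatrix_self])),
      Finset.sum_subtype (p := fun j => i ≠ j) _ (by simp)]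
    exact Finset.sum_congr rfl fun j _ => edgeMatrix_of_ne _ j.2
  have hinj : Function.Injective fun j : {j // i ≠ j} => EdgeIndex.mk i j.1 j.2 := by
    intro j j' h
    have := EdgeIndex.sym2_eq_of_mk_eq h
    exact Subtype.ext (Sym2.congr_right.1 this)
  have hcard : (Fintype.card {j // i ≠ j} : ℝ) ≤ n := by
    exact_mod_cast (Fintype.card_subtype_le _).trans_eq (Fintype.card_fin n)
  simp_rw [hsum]
  have h1 : 4 * k / t * R ≤ 1 := by
    rw [div_mul_eq_mul_div, div_le_one ht]
    nlinarith
  refine ((hY.precomp hinj).measureReal_le_sum_le (h := 4 * k / t) (by positivity) h1 t).trans ?_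
  rw [Real.exp_le_exp]
  have h2 : (4 * k / t) ^ 2 * (n * v) ≤ 16 * k / 60 := by
    rw [div_pow, div_mul_eq_mul_div, div_le_div_iff₀ (by positivity) (by norm_num)]
    nlinarith
  have h3 : (Fintype.card {j // i ≠ j} : ℝ) * ((4 * k / t) ^ 2 * v) ≤
      (4 * k / t) ^ 2 * (n * v) := by
    calc _ ≤ n * ((4 * k / t) ^ 2 * v) := by gcongr
      _ = _ := by ring
  have h4 : -(4 * k / t) * t = -(4 * k) := by field_simp
  rw [h4]
  linarith

theorem measureReal_trace_ge_le (hY : IsCenteredFamily P Y v R) (hR : 0 < R)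
    (hk : 1 ≤ k) (hkn : 2 * k ≤ n) (hvt : 60 * k * n * v ≤ t ^ 2) (hRt : 11 * k * R ≤ t) :
    P.real {ω | t ^ (2 * k) ≤ (edgeMatrix (fun e => Y e ω) ^ (2 * k)).trace} ≤
      n * Real.exp (-2 * k) := by
  have hk0 : (0 : ℝ) < k := by exact_mod_cast hk
  have hn0 : (0 : ℝ) < n := by exact_mod_cast (by omega : 0 < n)
  have ht : 0 < t := lt_of_lt_of_le (by positivity) hRt
  -- The trace bound needs the variance proxy to be at least `2 k R ^ 2 / n`.
  set v' := max v (2 * k * R ^ 2 / n)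
  have hv' : 8 * n * k * v' ≤ t ^ 2 / Real.exp 1 ^ 2 := by
    have he := exp_one_sq_le
    have h0 : 0 < Real.exp 1 ^ 2 := by positivity
    rw [le_div_iff₀ h0]
    have h1 : 8 * n * k * v' ≤ t ^ 2 / 7.39 := by
      rw [mul_max_of_nonneg _ _ (by positivity)]
      refine max_le ?_ ?_
      · rw [le_div_iff₀ (by norm_num)]
        nlinarith [sq_nonneg t]
      · have h2 : (11 * k * R) ^ 2 ≤ t ^ 2 := by gcongr
        have h3 : 8 * n * k * (2 * k * R ^ 2 / n) = 16 * (k * R) ^ 2 := by field_simp; ring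
        rw [h3, le_div_iff₀ (by norm_num)]
        nlinarith [sq_nonneg (k * R)]
    rw [le_div_iff₀ (by norm_num)] at h1
    have h2 : 0 ≤ 8 * n * k * v' := by
      have : 0 ≤ v' := le_max_of_le_right (by positivity)
      positivity
    nlinarith
  have hRv : 2 * k * R ^ 2 ≤ n * v' := by
    have := le_max_right v (2 * k * R ^ 2 / n)
    rw [div_le_iff₀ hn0] at this
    linarith
  have htr := (hY.mono (le_max_left v (2 * k * R ^ 2 / n))).integral_trace_pow_le hR hk hkn hRv
  have hM := mul_meas_ge_le_integral_of_nonneg (μ := P)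
    (ae_of_all _ fun ω => (edgeMatrix_isHermitian (fun e => Y e ω)).trace_pow_two_mul_nonneg k)
    (hY.integrable_trace_pow (2 * k)) (t ^ (2 * k))
  have hpow : (8 * n * k * v') ^ k ≤ t ^ (2 * k) * Real.exp (-2 * k) := by
    have h2 : 0 ≤ 8 * n * k * v' := by
      have : 0 ≤ v' := le_max_of_le_right (by positivity)
      positivity
    calc _ ≤ (t ^ 2 / Real.exp 1 ^ 2) ^ k := by gcongr
      _ = _ := by rw [div_pow, ← pow_mul t, Real.exp_neg_two_mul_natCast, div_eq_mul_inv]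
  have hfin : t ^ (2 * k) *
      P.real {ω | t ^ (2 * k) ≤ (edgeMatrix (fun e => Y e ω) ^ (2 * k)).trace} ≤
      t ^ (2 * k) * (n * Real.exp (-2 * k)) := by
    refine (hM.trans htr).trans ?_
    calc _ ≤ n * (t ^ (2 * k) * Real.exp (-2 * k)) := by gcongr
      _ = _ := by ring
  exact le_of_mul_le_mul_left hfin (by positivity)

theorem measureReal_not_isSpectrallyBounded_le (hY : IsCenteredFamily P Y v R) (hR : 0 < R)
    (hv : 0 ≤ v) (hk : 1 ≤ k) (hkn : 2 * k ≤ n) (hvt : 60 * k * n * v ≤ t ^ 2)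
    (hRt : 11 * k * R ≤ t) :
    P.real {ω | ¬ IsSpectrallyBounded (fun e => Y e ω) t} ≤ 2 * n * Real.exp (-2 * k) := by
  have ht : 0 ≤ t := le_trans (by positivity) hRt
  have hsub : {ω | ¬ IsSpectrallyBounded (fun e => Y e ω) t} ⊆
      (⋃ i, {ω | t ≤ ∑ j, edgeMatrix (fun e => Y e ω) i j}) ∪
        {ω | t ^ (2 * k) ≤ (edgeMatrix (fun e => Y e ω) ^ (2 * k)).trace} := by
    intro ω hω
    by_contra hcon
    simp only [Set.mem_union, Set.mem_iUnion, Set.mem_ofPred_eq, not_or, not_exists, not_le]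
      at hcon
    exact hω ⟨fun i => (hcon.1 i).le,
      (edgeMatrix_isHermitian _).neg_quadForm_le_of_trace_pow_le ht hk hcon.2.le⟩
  refine (measureReal_mono hsub).trans ((measureReal_union_le _ _).trans ?_)
  have h1 : P.real (⋃ i, {ω | t ≤ ∑ j, edgeMatrix (fun e => Y e ω) i j}) ≤
      n * Real.exp (-2 * k) := by
    refine (measureReal_iUnion_fintype_le _).trans ?_
    refine (Finset.sum_le_card_nsmul _ _ _ fun i _ =>
      hY.measureReal_row_sum_ge_le hR hv hk hvt hRt i).trans_eq ?_
    simp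
  linarith [hY.measureReal_trace_ge_le hR hk hkn hvt hRt]

end IsCenteredFamily

/-- The deterministic criterion: the constant part `μ` of the weights makes the total weight large,
and the random part is too small to produce a large Laplacian eigenvalue. -/
theorem WeightedGraph.satisfiesBrouwer_of_isSpectrallyBounded {n : ℕ} (G : WeightedGraph n)
    {μ β : ℝ} (y : EdgeIndex n → ℝ) (hμ : 0 ≤ μ) (hμ1 : μ ≤ 1 / 100) (hβ : 0 ≤ β)
    (hβμ : 20 * β ≤ Real.sqrt μ)
    (hw : ∀ e : EdgeIndex n, |G.weight e.1.1 e.1.2 - μ - y e| ≤ β)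
    (hy : IsSpectrallyBounded y (n * Real.sqrt μ / 5))
    (he : μ * n ^ 2 / 4 ≤ G.totalWeight) : G.SatisfiesBrouwer := by
  have hs := Real.sq_sqrt hμ
  have hs0 := Real.sqrt_nonneg μ
  set s := Real.sqrt μ
  have hs1 : s ≤ 1 / 10 := by nlinarith
  have hn0 : (0 : ℝ) ≤ n := n.cast_nonneg
  refine G.satisfiesBrouwer_of_eigenvalues₀_le (Λ := 7 / 10 * (n * s)) (by positivity) (fun i => ?_)
    ?_
  · refine (G.eigenvalues₀_laplacian_le y hμ hβ hw hy.1 hy.2 i).trans ?_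
    have h1 : n * μ ≤ n * s / 10 := by
      rw [mul_div_assoc]
      gcongr
      nlinarith
    have h2 : n * (20 * β) ≤ n * s := by gcongr
    have h3 : n * (20 * β) = 20 * (n * β) := by ring
    have h4 : 0 ≤ n * s := by positivity
    linarith
  · refine le_trans ?_ he
    rw [← hs]
    nlinarith [mul_nonneg hn0 hs0, sq_nonneg (n * s)]

/-! ### Truncation -/

/-- The value `x` if `|x| ≤ ρ`, and `0` otherwise. -/
noncomputable def truncate (ρ x : ℝ) : ℝ := if |x| ≤ ρ then x else 0

theorem measurable_truncate (ρ : ℝ) : Measurable (truncate ρ) :=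
  Measurable.ite (measurableSet_le measurable_id.abs measurable_const) measurable_id
    measurable_const

theorem abs_truncate_le {ρ : ℝ} (hρ : 0 ≤ ρ) (x : ℝ) : |truncate ρ x| ≤ ρ := by
  unfold truncate
  split_ifs with h
  · exact h
  · simpa using hρ

theorem truncate_sq_le (ρ x : ℝ) : truncate ρ x ^ 2 ≤ x ^ 2 := by
  unfold truncate
  split_ifs
  · exact le_rfl
  · simpa using sq_nonneg x

theorem one_le_rpow_div {u r p : ℝ} (hr : 0 < r) (hp : 0 ≤ p) (hu : r < u) :
    1 ≤ u ^ p * r ^ (-p) := by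
  rw [Real.rpow_neg hr.le, ← div_eq_mul_inv, one_le_div (Real.rpow_pos_of_pos hr p)]
  exact Real.rpow_le_rpow hr.le hu.le hp

section Truncation

variable {Ω : Type*} [MeasurableSpace Ω] {P : Measure Ω} [IsProbabilityMeasure P]
  {X : Ω → ℝ} {σ r p M : ℝ}

theorem measureReal_lt_abs_le_of_moment (hσ : 0 < σ) (hr : 0 < r) (hp : 0 ≤ p)
    (hX : Measurable X) (hi : Integrable (fun ω => |X ω / σ| ^ p) P)
    (hM : ∫ ω, |X ω / σ| ^ p ∂P ≤ M) : P.real {ω | σ * r < |X ω|} ≤ M * r ^ (-p) := by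
  have hmeas : MeasurableSet {ω | σ * r < |X ω|} := measurableSet_lt measurable_const hX.abs
  rw [← integral_indicator_one hmeas]
  calc _ ≤ ∫ ω, |X ω / σ| ^ p * r ^ (-p) ∂P := by
        refine integral_mono ((integrable_const (1 : ℝ)).indicator hmeas) (hi.mul_const _)
          fun ω => ?_
        by_cases h : σ * r < |X ω|
        · rw [Set.indicator_of_mem (by exact h)]
          refine one_le_rpow_div hr hp ?_
          rwa [abs_div, abs_of_pos hσ, lt_div_iff₀' hσ]
        · rw [Set.indicator_of_notMem (by exact h)]
          positivity
    _ ≤ _ := by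
        rw [integral_mul_const]
        gcongr

theorem abs_integral_truncate_le_of_moment (hσ : 0 < σ) (hr : 0 < r) (hp : 1 ≤ p)
    (hX : Measurable X) (hX1 : Integrable X P) (h0 : ∫ ω, X ω ∂P = 0)
    (hi : Integrable (fun ω => |X ω / σ| ^ p) P) (hM : ∫ ω, |X ω / σ| ^ p ∂P ≤ M) :
    |∫ ω, truncate (σ * r) (X ω) ∂P| ≤ M * σ * r ^ (-(p - 1)) := by
  have hT : Integrable (fun ω => truncate (σ * r) (X ω)) P :=
    Integrable.of_bound ((measurable_truncate _).comp hX).aestronglyMeasurable (σ * r)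
      (ae_of_all _ fun ω => abs_truncate_le (by positivity) _)
  have h1 : ∫ ω, truncate (σ * r) (X ω) ∂P = ∫ ω, (truncate (σ * r) (X ω) - X ω) ∂P := by
    rw [integral_sub hT hX1, h0, sub_zero]
  rw [h1]
  refine abs_integral_le_integral_abs.trans ?_
  calc _ ≤ ∫ ω, |X ω / σ| ^ p * (σ * r ^ (-(p - 1))) ∂P := by
        refine integral_mono (hT.sub hX1).abs (hi.mul_const _) fun ω => ?_
        dsimp only [Pi.sub_apply]
        unfold truncate
        split_ifs with h
        · simp only [sub_self, abs_zero]
          positivity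
        · rw [zero_sub, abs_neg]
          rw [not_le] at h
          have hu : r < |X ω / σ| := by rwa [abs_div, abs_of_pos hσ, lt_div_iff₀' hσ]
          have hu0 : 0 < |X ω / σ| := hr.trans hu
          have h2 := one_le_rpow_div hr (sub_nonneg.2 hp) hu
          have h3 : |X ω| = σ * |X ω / σ| := by
            rw [abs_div, abs_of_pos hσ]
            field_simp
          have h4 : |X ω / σ| ^ p = |X ω / σ| ^ (p - 1) * |X ω / σ| := by
            rw [← Real.rpow_add_one hu0.ne', sub_add_cancel]
          rw [h4, h3]
          calc σ * |X ω / σ| = σ * |X ω / σ| * 1 := (mul_one _).symm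
            _ ≤ σ * |X ω / σ| * (|X ω / σ| ^ (p - 1) * r ^ (-(p - 1))) := by gcongr
            _ = _ := by ring
    _ ≤ M * (σ * r ^ (-(p - 1))) := by
        rw [integral_mul_const]
        gcongr
    _ = _ := by ring

end Truncation

namespace IsCenteredFamily

variable {Ω ι : Type*} [MeasurableSpace Ω] {P : Measure Ω} [IsProbabilityMeasure P]
  {X : ι → Ω → ℝ} {v R : ℝ}

theorem truncated (hX : IsCenteredFamily P X v R) {ρ : ℝ} (hρ : 0 ≤ ρ) :
    IsCenteredFamily P
      (fun i ω => truncate ρ (X i ω) - ∫ ω', truncate ρ (X i ω') ∂P) v (2 * ρ) := by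
  have hm : ∀ i, Measurable fun ω => truncate ρ (X i ω) := fun i =>
    (measurable_truncate ρ).comp (hX.measurable i)
  have hT : ∀ i, Integrable (fun ω => truncate ρ (X i ω)) P := fun i =>
    Integrable.of_bound (hm i).aestronglyMeasurable ρ (ae_of_all _ fun ω => abs_truncate_le hρ _)
  refine ⟨fun i => (hm i).sub_const _, ?_, fun i => ae_of_all _ fun ω => ?_, fun i => ?_,
    fun i => ?_⟩
  · exact hX.indep.comp (fun i x => truncate ρ x - ∫ ω', truncate ρ (X i ω') ∂P)
      fun i => (measurable_truncate ρ).sub_const _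
  · have h1 : |∫ ω', truncate ρ (X i ω') ∂P| ≤ ρ := by
      have := norm_integral_le_of_norm_le_const (μ := P)
        (f := fun ω => truncate ρ (X i ω)) (C := ρ) (ae_of_all _ fun ω => abs_truncate_le hρ (X i ω))
      simpa using this
    have := abs_sub (truncate ρ (X i ω)) (∫ ω', truncate ρ (X i ω') ∂P)
    linarith [abs_truncate_le hρ (X i ω)]
  · rw [integral_sub (hT i) (integrable_const _)]
    simp
  · rw [← variance_eq_integral (hm i).aemeasurable]
    refine (variance_le_expectation_sq (hm i).aestronglyMeasurable).trans ?_
    refine le_trans ?_ (hX.second i)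
    refine integral_mono_of_nonneg (ae_of_all _ fun ω => sq_nonneg _) (hX.integrable_pow i 2)
      (ae_of_all _ fun ω => truncate_sq_le ρ (X i ω))

theorem integrable_abs_div_rpow (hX : IsCenteredFamily P X v R) (i : ι) {σ p : ℝ} (hσ : 0 < σ)
    (hp : 0 ≤ p) : Integrable (fun ω => |X i ω / σ| ^ p) P := by
  refine Integrable.of_bound (((hX.measurable i).div_const σ).abs.pow_const p).aestronglyMeasurable
    ((R / σ) ^ p) ?_
  filter_upwards [hX.bound i] with ω hω
  rw [Real.norm_eq_abs, abs_of_nonneg (by positivity), abs_div, abs_of_pos hσ]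
  gcongr

theorem integral_pow_four_le (hX : IsCenteredFamily P X v R) (i : ι) {σ p M : ℝ} (hσ : 0 < σ)
    (hp : 4 ≤ p) (hM : ∫ ω, |X i ω / σ| ^ p ∂P ≤ M) :
    ∫ ω, X i ω ^ 4 ∂P ≤ (1 + M) * σ ^ 4 := by
  have hi := hX.integrable_abs_div_rpow i hσ (by linarith : (0 : ℝ) ≤ p)
  calc _ ≤ ∫ ω, (1 + |X i ω / σ| ^ p) * σ ^ 4 ∂P := by
        refine integral_mono (hX.integrable_pow i 4)
          (((integrable_const _).fun_add hi).mul_const _) fun ω => ?_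
        have h1 : X i ω ^ 4 = |X i ω / σ| ^ 4 * σ ^ 4 := by
          rw [Even.pow_abs (by decide), div_pow]
          field_simp
        dsimp only
        rw [h1]
        gcongr
        rcases le_total |X i ω / σ| 1 with h | h
        · have : |X i ω / σ| ^ 4 ≤ 1 := pow_le_one₀ (abs_nonneg _) h
          have : 0 ≤ |X i ω / σ| ^ p := by positivity
          linarith
        · have := Real.rpow_le_rpow_of_exponent_le h hp
          rw [show (4 : ℝ) = (4 : ℕ) by norm_num, Real.rpow_natCast] at this
          linarith
    _ ≤ _ := by
        rw [integral_mul_const, integral_add (integrable_const _) hi]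
        simp only [integral_const, probReal_univ, smul_eq_mul, mul_one]
        gcongr

end IsCenteredFamily

theorem card_edgeIndex (n : ℕ) : (Fintype.card (EdgeIndex n) : ℝ) = n * (n - 1) / 2 := by
  have h1 : Fintype.card (EdgeIndex n) = ∑ i ∈ Finset.range n, i := by
    rw [Fintype.card_subtype, Finset.card_filter, Fintype.sum_prod_type, Finset.sum_comm,
      ← Fin.sum_univ_eq_sum_range (fun i => i)]
    refine Finset.sum_congr rfl fun v _ => ?_
    rw [← Finset.card_filter]
    exact (congrArg Finset.card (by ext; simp)).trans (Fin.card_Iio v)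
  have h2 : ((∑ i ∈ Finset.range n, i : ℕ) : ℝ) * 2 = n * (n - 1) := by
    rcases Nat.eq_zero_or_pos n with rfl | hn
    · simp
    · have := Finset.sum_range_id_mul_two n
      rw [← Nat.cast_pred hn]
      exact_mod_cast this
  rw [h1]
  linarith

/-! ### The two regimes of the mean -/

section Regimes

variable {Ω : Type*} [MeasurableSpace Ω] {P : Measure Ω} [IsProbabilityMeasure P] {n : ℕ}
  {G : Ω → WeightedGraph n} {μ v B R : ℝ}

theorem WeightedGraph.totalWeight_eq_add_sum (G : WeightedGraph n) (μ : ℝ) :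
    G.totalWeight = n * (n - 1) / 2 * μ + ∑ e : EdgeIndex n, (G.weight e.1.1 e.1.2 - μ) := by
  rw [G.totalWeight_eq_sum_edgeIndex, Finset.sum_sub_distrib, ← card_edgeIndex]
  simp

theorem measureReal_totalWeight_lt_le
    (hX : IsCenteredFamily P (fun (e : EdgeIndex n) ω => (G ω).weight e.1.1 e.1.2 - μ) v R)
    (hμ : 0 < μ) (hn : 8 ≤ n) (hR : 64 * R ≤ n) (hv0 : 0 ≤ v) (hv : 1024 * v ≤ μ * n) :
    P.real {ω | (G ω).totalWeight < μ * n ^ 2 / 4} ≤ Real.exp (-2 * (μ * n)) := by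
  have hn' : (8 : ℝ) ≤ n := by exact_mod_cast hn
  have hn0 : (0 : ℝ) < n := by linarith
  have hsub : {ω | (G ω).totalWeight < μ * n ^ 2 / 4} ⊆
      {ω | μ * n ^ 2 / 16 ≤ ∑ e : EdgeIndex n, -((G ω).weight e.1.1 e.1.2 - μ)} := by
    intro ω hω
    simp only [Set.mem_ofPred_eq] at hω ⊢
    rw [(G ω).totalWeight_eq_add_sum μ] at hω
    rw [Finset.sum_neg_distrib]
    nlinarith [mul_nonneg hμ.le (mul_nonneg hn0.le (sub_nonneg.2 hn'))]
  refine (measureReal_mono hsub).trans ?_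
  have h1 : 64 / n * R ≤ 1 := by rw [div_mul_eq_mul_div, div_le_one hn0]; exact hR
  refine (hX.neg.measureReal_le_sum_le (h := 64 / n) (by positivity) h1 _).trans ?_
  rw [Real.exp_le_exp, card_edgeIndex]
  have h2 : n * (n - 1) / 2 * ((64 / n) ^ 2 * v) ≤ 2048 * v := by
    calc n * (n - 1) / 2 * ((64 / n) ^ 2 * v) ≤ n * n / 2 * ((64 / n) ^ 2 * v) := by
          gcongr
          linarith
      _ = 2048 * v := by field_simp; ring
  have h3 : -(64 / n) * (μ * n ^ 2 / 16) = -4 * (μ * n) := by field_simp; norm_num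
  rw [h3]
  linarith

/-- The order `k`, about `log n + c μ n`, of the trace moment that is used when `n μ ≥ 1`. -/
theorem exists_moment_order
    (hμ : 0 < μ) (hμ1 : μ ≤ 1 / 100) (hμn : 1 ≤ μ * n) (hn : 8 ≤ n) (hB : 1 ≤ B) (hv0 : 0 ≤ v)
    (hvB : v ≤ B ^ 2) (hv : v * Real.log n ≤ μ * n / 6000)
    (hlog : 440 * B * Real.log n ≤ Real.sqrt n) :
    ∃ k : ℕ, 1 ≤ k ∧ 2 * k ≤ n ∧ 60 * k * n * v ≤ (n * Real.sqrt μ / 5) ^ 2 ∧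
      11 * k * (2 * B) ≤ n * Real.sqrt μ / 5 ∧
      2 * n * Real.exp (-2 * k) ≤ 1 / 4 * Real.exp (-(1 / (3000 * B ^ 2)) * (μ * n)) := by
  have hn' : (8 : ℝ) ≤ n := by exact_mod_cast hn
  have hn0 : (0 : ℝ) < n := by linarith
  have hlog1 : 1 ≤ Real.log n := by
    rw [Real.le_log_iff_exp_le hn0]
    linarith [Real.exp_one_lt_three]
  set c : ℝ := 1 / (3000 * B ^ 2) with hc
  have hc0 : 0 < c := by positivity
  have hcB : c * B ^ 2 = 1 / 3000 := by rw [hc]; field_simp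
  have hB2 : B ≤ B ^ 2 := by nlinarith
  have hcB1 : c * B ≤ 1 / 3000 := by rw [← hcB]; gcongr
  have hc1 : c ≤ 1 / 3000 := by nlinarith
  have hcv : c * v ≤ 1 / 3000 := by rw [← hcB]; gcongr
  set s := Real.sqrt μ with hs
  have hs2 : s ^ 2 = μ := Real.sq_sqrt hμ.le
  have hs0 : 0 < s := Real.sqrt_pos.2 hμ
  have hs1 : s ≤ 1 / 10 := by nlinarith
  have hsn : Real.sqrt n ≤ n * s := by
    rw [Real.sqrt_le_left (by positivity), mul_pow, hs2]
    nlinarith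
  have hsqn : Real.sqrt n ≤ n / 2 := by
    rw [Real.sqrt_le_left (by positivity)]
    nlinarith
  set k := ⌈Real.log n + c * (μ * n)⌉₊ with hk
  have hk_low : Real.log n + c * (μ * n) ≤ k := Nat.le_ceil _
  have hcμ0 : 0 ≤ c * (μ * n) := by positivity
  have hk_up : (k : ℝ) ≤ 2 * Real.log n + c * (μ * n) := by
    have := Nat.ceil_lt_add_one (a := Real.log n + c * (μ * n)) (by linarith)
    linarith
  have hk1 : 1 ≤ k := by
    have : (1 : ℝ) ≤ k := by linarith
    exact_mod_cast this
  have hlog2 : 440 * Real.log n ≤ 440 * B * Real.log n := by nlinarith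
  have hkn : 2 * k ≤ n := by
    have h2 : c * (μ * n) ≤ 1 / 3000 * (1 / 100 * n) := by gcongr
    have : (2 * k : ℝ) ≤ n := by linarith
    exact_mod_cast this
  have hkv : 60 * k * n * v ≤ (n * s / 5) ^ 2 := by
    have h1 : 1500 * (k * v) ≤ μ * n := by
      have h2 : k * v ≤ (2 * Real.log n + c * (μ * n)) * v := by gcongr
      have h3 : c * v * (μ * n) ≤ 1 / 3000 * (μ * n) := by gcongr
      have h5 : (2 * Real.log n + c * (μ * n)) * v = 2 * (v * Real.log n) + c * v * (μ * n) := by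
        ring
      linarith
    have h4 : n * (1500 * (k * v)) ≤ n * (μ * n) := by gcongr
    rw [div_pow, mul_pow, hs2]
    linarith
  have hkR : 11 * k * (2 * B) ≤ n * s / 5 := by
    have h1 : k * B ≤ (2 * Real.log n + c * (μ * n)) * B := by gcongr
    have h2 : c * B * (μ * n) ≤ 1 / 3000 * (μ * n) := by gcongr
    have h3 : μ * n ≤ 1 / 10 * s * n := by
      rw [← hs2, pow_two]
      gcongr
    have h4 : 0 ≤ s * n := by positivity
    have h5 : (2 * Real.log n + c * (μ * n)) * B = 2 * (B * Real.log n) + c * B * (μ * n) := by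
      ring
    linarith
  have hexp : 2 * n * Real.exp (-2 * k) ≤ 1 / 4 * Real.exp (-c * (μ * n)) := by
    have h3 : Real.exp (-2 * k) ≤ Real.exp (-c * (μ * n)) * (Real.exp (Real.log n))⁻¹ ^ 2 := by
      rw [← Real.exp_neg, ← Real.exp_nat_mul, ← Real.exp_add, Real.exp_le_exp]
      push_cast
      linarith
    rw [Real.exp_log hn0] at h3
    calc 2 * n * Real.exp (-2 * k) ≤ 2 * n * (Real.exp (-c * (μ * n)) * (n : ℝ)⁻¹ ^ 2) := by gcongr
      _ = 2 / n * Real.exp (-c * (μ * n)) := by field_simp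
      _ ≤ _ := by
        have h4 : 2 / (n : ℝ) ≤ 1 / 4 := by
          rw [div_le_div_iff₀ hn0 (by norm_num)]
          linarith
        exact mul_le_mul_of_nonneg_right h4 (Real.exp_pos _).le
  exact ⟨k, hk1, hkn, hkv, hkR, hexp⟩

/-- Failure probability when `n μ ≥ 1`. -/
theorem measureReal_not_satisfiesBrouwer_le
    (hX : IsCenteredFamily P (fun (e : EdgeIndex n) ω => (G ω).weight e.1.1 e.1.2 - μ) v (2 * B))
    (hμ : 0 < μ) (hμ1 : μ ≤ 1 / 100) (hμn : 1 ≤ μ * n) (hn : 8 ≤ n) (hB : 1 ≤ B) (hv0 : 0 ≤ v)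
    (hvB : v ≤ B ^ 2) (hv : v * Real.log n ≤ μ * n / 6000)
    (hlog : 440 * B * Real.log n ≤ Real.sqrt n) :
    P.real {ω | ¬ (G ω).SatisfiesBrouwer} ≤ Real.exp (-(1 / (3000 * B ^ 2)) * (μ * n)) := by
  have hn' : (8 : ℝ) ≤ n := by exact_mod_cast hn
  have hlog1 : 1 ≤ Real.log n := by
    rw [Real.le_log_iff_exp_le (by linarith)]
    linarith [Real.exp_one_lt_three]
  obtain ⟨k, hk1, hkn, hkv, hkR, h2⟩ := exists_moment_order hμ hμ1 hμn hn hB hv0 hvB hv hlog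
  set c : ℝ := 1 / (3000 * B ^ 2) with hc
  have hc1 : c ≤ 1 := by
    rw [hc, div_le_one (by positivity)]
    nlinarith
  have hRn : 64 * (2 * B) ≤ n := by
    have h3 : 440 * B ≤ 440 * B * Real.log n := le_mul_of_one_le_right (by positivity) hlog1
    have h4 : Real.sqrt n ≤ n := by
      rw [Real.sqrt_le_left (by positivity)]
      nlinarith
    linarith
  have hv' : 1024 * v ≤ μ * n := by
    have h3 : v ≤ v * Real.log n := le_mul_of_one_le_right hv0 hlog1
    linarith
  have hspec := hX.measureReal_not_isSpectrallyBounded_le (k := k) (t := n * Real.sqrt μ / 5)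
    (by positivity) hv0 hk1 hkn hkv hkR
  have hsub : {ω | ¬ (G ω).SatisfiesBrouwer} ⊆ {ω | (G ω).totalWeight < μ * n ^ 2 / 4} ∪
      {ω | ¬ IsSpectrallyBounded (fun e : EdgeIndex n => (G ω).weight e.1.1 e.1.2 - μ)
        (n * Real.sqrt μ / 5)} := by
    intro ω hω
    by_contra hcon
    simp only [Set.mem_union, Set.mem_ofPred_eq, not_or, not_lt, not_not] at hcon
    exact hω ((G ω).satisfiesBrouwer_of_isSpectrallyBounded (β := 0) _ hμ.le hμ1 le_rfl
      (by simp) (fun e => by simp) hcon.2 hcon.1)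
  have htot := measureReal_totalWeight_lt_le hX hμ hn hRn hv0 hv'
  refine (measureReal_mono hsub).trans ((measureReal_union_le _ _).trans ?_)
  have h1 : Real.exp (-2 * (μ * n)) ≤ 1 / 2 * Real.exp (-c * (μ * n)) := by
    have h2 : Real.exp (-1) ≤ 1 / 2 := by
      rw [Real.exp_neg, one_div]
      gcongr
      linarith [Real.exp_one_gt_d9]
    calc Real.exp (-2 * (μ * n)) ≤ Real.exp (-1 + -c * (μ * n)) := by
          rw [Real.exp_le_exp]
          have h3 : c * (μ * n) ≤ 1 * (μ * n) := by gcongr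
          linarith
      _ = Real.exp (-1) * Real.exp (-c * (μ * n)) := Real.exp_add _ _
      _ ≤ _ := by gcongr
  have := Real.exp_pos (-c * (μ * n))
  linarith

/-- The excess `∑ (w_e - μ)` of the total weight over its mean may be negative with probability
close to `1 / 2`, hence only a constant lower bound on the probability of success; this is all that
is needed when `n μ ≤ 1`. -/
theorem le_measureReal_satisfiesBrouwer {σ p M r : ℝ}
    (hX : IsCenteredFamily P (fun (e : EdgeIndex n) ω => (G ω).weight e.1.1 e.1.2 - μ)
      (σ ^ 2) B)
    (hσ : 0 < σ) (hvar : ∀ e : EdgeIndex n, ∫ ω, ((G ω).weight e.1.1 e.1.2 - μ) ^ 2 ∂P = σ ^ 2)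
    (hp : 4 ≤ p) (hM1 : 1 ≤ M)
    (hM : ∀ e : EdgeIndex n, ∫ ω, |((G ω).weight e.1.1 e.1.2 - μ) / σ| ^ p ∂P ≤ M)
    (hμ : 0 < μ) (hμ1 : μ ≤ 1 / 100) (hn : 8 ≤ n) (hv : σ ^ 2 * Real.log n ≤ μ * n / 6000)
    (hr : 1 ≤ r) (hrn : r ^ 3 = n) (hlog : 220 * Real.log n * r ≤ Real.sqrt n)
    (hMn : 20 * M ≤ Real.sqrt n)
    (htail : n ^ 2 * (M * r ^ (-p)) ≤ 1 / (12 * (M + 4) ^ 2) / 4)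
    (hlarge : 2 / n ≤ 1 / (12 * (M + 4) ^ 2) / 4) :
    1 / (12 * (M + 4) ^ 2) / 2 ≤ P.real {ω | (G ω).SatisfiesBrouwer} := by
  have hn' : (8 : ℝ) ≤ n := by exact_mod_cast hn
  have hn0 : (0 : ℝ) < n := by linarith
  have hr0 : 0 < r := by linarith
  have hlog1 : 1 ≤ Real.log n := by
    rw [Real.le_log_iff_exp_le hn0]
    linarith [Real.exp_one_lt_three]
  set s := Real.sqrt μ with hs
  have hs2 : s ^ 2 = μ := Real.sq_sqrt hμ.le
  have hs0 : 0 < s := Real.sqrt_pos.2 hμ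
  have hqn : Real.sqrt n ^ 2 = n := Real.sq_sqrt hn0.le
  have hq0 : 0 < Real.sqrt n := Real.sqrt_pos.2 hn0
  set q := Real.sqrt n
  have hσs : σ * q ≤ n * s := by
    refine (pow_le_pow_iff_left₀ (by positivity) (by positivity) two_ne_zero).1 ?_
    have h1 : σ ^ 2 ≤ μ * n := by nlinarith [sq_nonneg σ]
    have h2 : n * σ ^ 2 ≤ n * (μ * n) := by gcongr
    rw [mul_pow, mul_pow, hs2, hqn]
    linarith
  set X : EdgeIndex n → Ω → ℝ := fun e ω => (G ω).weight e.1.1 e.1.2 - μ with hXdef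
  -- The total weight is at least its mean with probability bounded below.
  set N : ℝ := n * (n - 1) / 2 with hN
  have hN1 : 1 ≤ N := by rw [hN]; nlinarith
  have hS : 1 / (12 * (M + 4) ^ 2) ≤ P.real {ω | 0 ≤ ∑ e, X e ω} := by
    refine le_measureReal_nonneg_of_moments (V := N * σ ^ 2) (Q := M + 4) (by positivity)
      (by linarith) (Finset.measurable_sum _ fun e _ => hX.measurable e)
      (hX.integrable_sum_pow Finset.univ) (hX.integral_sum Finset.univ) ?_ ?_
    · rw [hX.integral_sum_sq hvar, Finset.card_univ, card_edgeIndex]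
    · refine (hX.integral_sum_pow_four_le hvar
        (fun e => hX.integral_pow_four_le e hσ hp (hM e)) Finset.univ).trans ?_
      rw [Finset.card_univ, card_edgeIndex, ← hN]
      have : N ≤ N ^ 2 := by nlinarith
      have h4 : 0 ≤ (1 + M) * σ ^ 4 := by positivity
      nlinarith
  -- Truncation at `σ r`.
  set Y : EdgeIndex n → Ω → ℝ := fun e ω =>
    truncate (σ * r) (X e ω) - ∫ ω', truncate (σ * r) (X e ω') ∂P with hY
  have hYc : IsCenteredFamily P Y (σ ^ 2) (2 * (σ * r)) := hX.truncated (by positivity)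
  have hbias : ∀ e, |∫ ω, truncate (σ * r) (X e ω) ∂P| ≤ M * σ / n := by
    intro e
    refine (abs_integral_truncate_le_of_moment hσ hr0 (by linarith) (hX.measurable e)
      (by simpa using hX.integrable_pow e 1) (hX.mean e)
      (hX.integrable_abs_div_rpow e hσ (by linarith)) (hM e)).trans ?_
    rw [div_eq_mul_inv, ← hrn, ← Real.rpow_natCast, ← Real.rpow_neg hr0.le]
    refine mul_le_mul_of_nonneg_left (Real.rpow_le_rpow_of_exponent_le hr ?_) (by positivity)
    push_cast
    linarith
  have hbad : P.real (⋃ e, {ω | σ * r < |X e ω|}) ≤ n ^ 2 * (M * r ^ (-p)) := by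
    refine (measureReal_iUnion_fintype_le _).trans ?_
    refine (Finset.sum_le_card_nsmul _ _ _ fun e _ => measureReal_lt_abs_le_of_moment hσ hr0
      (by linarith) (hX.measurable e) (hX.integrable_abs_div_rpow e hσ (by linarith))
      (hM e)).trans ?_
    rw [nsmul_eq_mul, Finset.card_univ, card_edgeIndex]
    gcongr
    nlinarith
  set k := ⌈Real.log n⌉₊ with hk
  have hk_low : Real.log n ≤ k := Nat.le_ceil _
  have hk_up : (k : ℝ) ≤ 2 * Real.log n := by
    have := Nat.ceil_lt_add_one (a := Real.log n) (by linarith)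
    linarith
  have hk1 : 1 ≤ k := by
    have : (1 : ℝ) ≤ k := by linarith
    exact_mod_cast this
  have hkn : 2 * k ≤ n := by
    have h1 : 220 * Real.log n ≤ q := (le_mul_of_one_le_right (by positivity) hr).trans hlog
    have h2 : q ≤ n := by
      rw [← hqn, pow_two]
      exact le_mul_of_one_le_left hq0.le (by linarith)
    have : (2 * k : ℝ) ≤ n := by linarith
    exact_mod_cast this
  have hkv : 60 * k * n * σ ^ 2 ≤ (n * s / 5) ^ 2 := by
    have h2 : k * σ ^ 2 ≤ (2 * Real.log n) * σ ^ 2 := by gcongr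
    have h3 : 0 < μ * n := by positivity
    have h1 : 1500 * (k * σ ^ 2) ≤ μ * n := by linarith
    have h4 : n * (1500 * (k * σ ^ 2)) ≤ n * (μ * n) := by gcongr
    rw [div_pow, mul_pow, hs2]
    linarith
  have hkR : 11 * k * (2 * (σ * r)) ≤ n * s / 5 := by
    have h2 : k * (σ * r) ≤ (2 * Real.log n) * (σ * r) := by gcongr
    have h3 : σ * (220 * Real.log n * r) ≤ σ * q := by gcongr
    linarith
  have hspec := hYc.measureReal_not_isSpectrallyBounded_le (k := k) (t := n * s / 5)
    (by positivity) (sq_nonneg σ) hk1 hkn hkv hkR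
  have hspec' : 2 * n * Real.exp (-2 * k) ≤ 2 / n := by
    have h3 : Real.exp (-2 * k) ≤ (Real.exp (Real.log n))⁻¹ ^ 2 := by
      rw [← Real.exp_neg, ← Real.exp_nat_mul, Real.exp_le_exp]
      push_cast
      linarith
    rw [Real.exp_log hn0] at h3
    calc 2 * n * Real.exp (-2 * k) ≤ 2 * n * ((n : ℝ)⁻¹ ^ 2) := by gcongr
      _ = _ := by field_simp
  have hsub : {ω | 0 ≤ ∑ e, X e ω} ⊆ {ω | (G ω).SatisfiesBrouwer} ∪
      ((⋃ e, {ω | σ * r < |X e ω|}) ∪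
        {ω | ¬ IsSpectrallyBounded (fun e => Y e ω) (n * s / 5)}) := by
    intro ω hω
    by_contra hcon
    simp only [Set.mem_union, Set.mem_iUnion, Set.mem_ofPred_eq, not_or, not_exists, not_lt,
      not_not] at hcon hω
    refine hcon.1 ((G ω).satisfiesBrouwer_of_isSpectrallyBounded (β := M * σ / n)
      (fun e => Y e ω) hμ.le hμ1 (by positivity) ?_ (fun e => ?_) hcon.2.2 ?_)
    · rw [← mul_div_assoc, div_le_iff₀ hn0]
      have h1 : 20 * M * σ ≤ q * σ := by gcongr
      linarith
    · have h1 : truncate (σ * r) (X e ω) = X e ω := if_pos (hcon.2.1 e)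
      have h2 : (G ω).weight e.1.1 e.1.2 - μ - Y e ω = ∫ ω', truncate (σ * r) (X e ω') ∂P := by
        simp only [hY, h1]
        simp only [hXdef]
        ring
      rw [h2]
      exact hbias e
    · rw [(G ω).totalWeight_eq_add_sum μ]
      refine le_add_of_le_of_nonneg ?_ hω
      have h1 : 0 ≤ μ * n * (n - 2) := mul_nonneg (by positivity) (by linarith)
      linarith
  have h1 := measureReal_mono (μ := P) hsub
  have h2 := measureReal_union_le (μ := P) {ω | (G ω).SatisfiesBrouwer}
    ((⋃ e, {ω | σ * r < |X e ω|}) ∪ {ω | ¬ IsSpectrallyBounded (fun e => Y e ω) (n * s / 5)})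
  have h3 := measureReal_union_le (μ := P) (⋃ e, {ω | σ * r < |X e ω|})
    {ω | ¬ IsSpectrallyBounded (fun e => Y e ω) (n * s / 5)}
  linarith

end Regimes

/-! ### Asymptotics -/

theorem eventually_mul_log_mul_rpow_le (K : ℝ) {a b : ℝ} (h : a < b) :
    ∀ᶠ n : ℕ in atTop, K * Real.log n * (n : ℝ) ^ a ≤ (n : ℝ) ^ b := by
  have h1 := (isLittleO_log_rpow_atTop (sub_pos.2 h)).bound
    (show (0 : ℝ) < 1 / (|K| + 1) by positivity)
  filter_upwards [tendsto_natCast_atTop_atTop.eventually h1, eventually_ge_atTop 1] with n hn hn1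
  have hn0 : (0 : ℝ) < n := by exact_mod_cast hn1
  have hlog : 0 ≤ Real.log n := Real.log_natCast_nonneg n
  rw [Real.norm_eq_abs, abs_of_nonneg hlog, Real.norm_eq_abs,
    abs_of_nonneg (Real.rpow_nonneg hn0.le _), div_mul_eq_mul_div, one_mul,
    le_div_iff₀ (by positivity)] at hn
  calc K * Real.log n * (n : ℝ) ^ a ≤ Real.log n * (|K| + 1) * (n : ℝ) ^ a := by
        rw [mul_comm K]
        gcongr
        linarith [le_abs_self K]
    _ ≤ (n : ℝ) ^ (b - a) * (n : ℝ) ^ a := by gcongr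
    _ = (n : ℝ) ^ b := by rw [← Real.rpow_add hn0, sub_add_cancel]

namespace IsRandomGraphSequence

variable {Ω : Type*} [MeasurableSpace Ω] {P : Measure Ω}
  {G : (n : ℕ) → Ω → WeightedGraph n} {μ σ : ℕ → ℝ}

theorem integral_sub_mean_sq (hG : IsRandomGraphSequence P G μ σ) {n : ℕ} (e : EdgeIndex n) :
    ∫ ω, ((G n ω).weight e.1.1 e.1.2 - μ n) ^ 2 ∂P = σ n ^ 2 := by
  rw [← hG.var n _ _ e.2, variance_eq_integral (hG.measurable n _ _ e.2).aemeasurable,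
    hG.mean n _ _ e.2]

variable [IsProbabilityMeasure P]

theorem integrable_weight (hG : IsRandomGraphSequence P G μ σ) {n : ℕ} (e : EdgeIndex n) :
    Integrable (fun ω => (G n ω).weight e.1.1 e.1.2) P := by
  obtain ⟨B, hB⟩ := hG.bounded
  exact Integrable.of_bound (hG.measurable n _ _ e.2).aestronglyMeasurable B (hB n _ _ e.2)

theorem isCenteredFamily (hG : IsRandomGraphSequence P G μ σ) {B : ℝ}
    (hB : ∀ (n : ℕ) (i j : Fin n), i < j → ∀ᵐ ω ∂P, |(G n ω).weight i j| ≤ B) (n : ℕ) :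
    IsCenteredFamily P (fun (e : EdgeIndex n) ω => (G n ω).weight e.1.1 e.1.2 - μ n)
      (σ n ^ 2) (2 * B) where
  measurable e := (hG.measurable n _ _ e.2).sub_const _
  indep := (hG.indep n).comp (fun _ x => x - μ n) fun _ => measurable_id.sub_const _
  bound e := by
    have hμ : |μ n| ≤ B := by
      rw [← hG.mean n _ _ e.2]
      have h := norm_integral_le_of_norm_le_const (μ := P)
        (f := fun ω => (G n ω).weight e.1.1 e.1.2) (C := B) (hB n _ _ e.2)
      simpa using h
    filter_upwards [hB n _ _ e.2] with ω hω
    linarith [abs_sub ((G n ω).weight e.1.1 e.1.2) (μ n)]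
  mean e := by
    rw [integral_sub (hG.integrable_weight e) (integrable_const _), hG.mean n _ _ e.2]
    simp
  second e := (hG.integral_sub_mean_sq e).le

theorem sq_le_sq_of_bounded (hG : IsRandomGraphSequence P G μ σ) {B : ℝ}
    (hB : ∀ (n : ℕ) (i j : Fin n), i < j → ∀ᵐ ω ∂P, |(G n ω).weight i j| ≤ B) {n : ℕ}
    (hn : 2 ≤ n) : σ n ^ 2 ≤ B ^ 2 := by
  have hij : (⟨0, by omega⟩ : Fin n) < ⟨1, by omega⟩ := by simp
  have hm := hG.measurable n _ _ hij
  rw [← hG.var n _ _ hij]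
  refine (variance_le_expectation_sq hm.aestronglyMeasurable).trans ?_
  have hle : ∀ᵐ ω ∂P, (G n ω).weight ⟨0, by omega⟩ ⟨1, by omega⟩ ^ 2 ≤ B ^ 2 := by
    filter_upwards [hB n _ _ hij] with ω hω
    rw [← sq_abs]
    gcongr
  calc _ ≤ ∫ _ω, B ^ 2 ∂P := integral_mono_of_nonneg (ae_of_all _ fun ω => sq_nonneg _)
        (integrable_const _) hle
    _ = B ^ 2 := by simp

/-- Since the standard deviations are bounded, the means are eventually small. -/
theorem eventually_mean_le (hG : IsRandomGraphSequence P G μ σ) {B : ℝ} (hB1 : 1 ≤ B)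
    (hB : ∀ (n : ℕ) (i j : Fin n), i < j → ∀ᵐ ω ∂P, |(G n ω).weight i j| ≤ B)
    (hsparse : Tendsto (fun n : ℕ => μ n / σ n * ((n : ℝ) / Real.log n) ^ (1 / 2 : ℝ))
      atTop (𝓝 0)) : ∀ᶠ n in atTop, μ n ≤ 1 / 100 := by
  have hev := hsparse.eventually (gt_mem_nhds (show (0 : ℝ) < 1 / (100 * B) by positivity))
  filter_upwards [hev, eventually_ge_atTop 3] with n hn hn3
  rcases le_total (μ n) 0 with h | h
  · linarith
  have hσ := hG.sd_pos n (by omega)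
  have hσB : σ n ≤ B := by
    have := hG.sq_le_sq_of_bounded hB (n := n) (by omega)
    exact (pow_le_pow_iff_left₀ hσ.le (by linarith) two_ne_zero).1 this
  have hn0 : (0 : ℝ) < n := by exact_mod_cast (by omega : 0 < n)
  have hlog0 : 0 < Real.log n := Real.log_pos (by exact_mod_cast (by omega : 1 < n))
  have h1 : 1 ≤ ((n : ℝ) / Real.log n) ^ (1 / 2 : ℝ) := by
    refine Real.one_le_rpow ?_ (by norm_num)
    rw [one_le_div hlog0]
    linarith [Real.log_le_sub_one_of_pos hn0]
  have h2 : μ n / σ n < 1 / (100 * B) :=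
    (le_mul_of_one_le_right (by positivity) h1).trans_lt hn
  rw [div_lt_div_iff₀ hσ (by positivity)] at h2
  have h3 : μ n * (100 * B) < B := by linarith
  nlinarith

theorem eventually_variance_mul_log_le
    (hvar : Tendsto (fun n : ℕ => (σ n) ^ 2 * (Real.log n / (μ n * n))) atTop (𝓝 0)) :
    ∀ᶠ n : ℕ in atTop, 0 < μ n → σ n ^ 2 * Real.log n ≤ μ n * n / 6000 := by
  have hev := hvar.eventually (gt_mem_nhds (show (0 : ℝ) < 1 / 6000 by norm_num))
  filter_upwards [hev, eventually_ge_atTop 1] with n hn hn1 hμ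
  have hn0 : (0 : ℝ) < n := by exact_mod_cast hn1
  rw [← mul_div_assoc, div_lt_iff₀ (by positivity)] at hn
  linarith

end IsRandomGraphSequence

theorem one_sub_measureReal_not_le {Ω : Type*} [MeasurableSpace Ω] (P : Measure Ω)
    [IsProbabilityMeasure P] (p : Ω → Prop) : 1 - P.real {ω | ¬ p ω} ≤ P.real {ω | p ω} := by
  have h := measureReal_union_le (μ := P) {ω | p ω} {ω | ¬ p ω}
  have hu : {ω | p ω} ∪ {ω | ¬ p ω} = Set.univ := by
    ext ω
    simpa using em (p ω)
  rw [hu, probReal_univ] at h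
  linarith

theorem theorem2 {Ω : Type*} [MeasurableSpace Ω] (P : Measure Ω) [IsProbabilityMeasure P]
    (G : (n : ℕ) → Ω → WeightedGraph n) (μ σ : ℕ → ℝ)
    (hG : IsRandomGraphSequence P G μ σ)
    (hsparse : Tendsto (fun n : ℕ => μ n / σ n * ((n : ℝ) / Real.log n) ^ (1 / 2 : ℝ))
      atTop (𝓝 0))
    (hvar : Tendsto (fun n : ℕ => (σ n) ^ 2 * (Real.log n / (μ n * n))) atTop (𝓝 0)) :
    ∃ C : ℝ, 0 < C ∧ ∀ᶠ n : ℕ in atTop,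
      1 - Real.exp (-C * μ n * n) ≤ P.real {ω | (G n ω).SatisfiesBrouwer} := by
  obtain ⟨B, hB1, hB⟩ : ∃ B : ℝ, 1 ≤ B ∧
      ∀ (n : ℕ) (i j : Fin n), i < j → ∀ᵐ ω ∂P, |(G n ω).weight i j| ≤ B := by
    obtain ⟨B, hB⟩ := hG.bounded
    refine ⟨max B 1, le_max_right _ _, fun n i j hij => ?_⟩
    filter_upwards [hB n i j hij] with ω hω using hω.trans (le_max_left _ _)
  obtain ⟨p, hp, M, hM1, hM⟩ : ∃ p : ℝ, 6 < p ∧ ∃ M : ℝ, 1 ≤ M ∧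
      ∀ (n : ℕ) (i j : Fin n), i < j →
        ∫ ω, |((G n ω).weight i j - μ n) / σ n| ^ p ∂P ≤ M := by
    obtain ⟨p, hp, M, hM⟩ := hG.moment
    exact ⟨p, hp, max M 1, le_max_right _ _, fun n i j hij =>
      (hM n i j hij).trans (le_max_left _ _)⟩
  set c₀ : ℝ := 1 / (12 * (M + 4) ^ 2) with hc₀
  have hc₀0 : 0 < c₀ := by positivity
  set C : ℝ := min (1 / (3000 * B ^ 2)) (c₀ / 2) with hC
  have hC0 : 0 < C := by positivity
  have hsqrt : ∀ᶠ n : ℕ in atTop, 20 * M ≤ Real.sqrt n :=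
    (Real.tendsto_sqrt_atTop.comp tendsto_natCast_atTop_atTop).eventually_ge_atTop _
  have hlarge : ∀ᶠ n : ℕ in atTop, 2 / (n : ℝ) ≤ c₀ / 4 := by
    have h := (tendsto_const_div_atTop_nhds_zero_nat (2 : ℝ)).eventually
      (gt_mem_nhds (show 0 < c₀ / 4 by positivity))
    exact h.mono fun n hn => hn.le
  -- This is where `p > 6` enters: all `n ^ 2` weights are truncated at `σ n ^ (1 / 3)`.
  have htail : ∀ᶠ n : ℕ in atTop,
      (n : ℝ) ^ 2 * (M * ((n : ℝ) ^ (1 / 3 : ℝ)) ^ (-p)) ≤ c₀ / 4 := by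
    have h0 : Tendsto (fun n : ℕ => M * (n : ℝ) ^ (-(p / 3 - 2))) atTop (𝓝 (M * 0)) :=
      ((tendsto_rpow_neg_atTop (by linarith)).comp tendsto_natCast_atTop_atTop).const_mul M
    rw [mul_zero] at h0
    filter_upwards [h0.eventually (gt_mem_nhds (show 0 < c₀ / 4 by positivity)),
      eventually_ge_atTop 1] with n hn hn1
    have hn0 : (0 : ℝ) < n := by exact_mod_cast hn1
    refine le_trans (le_of_eq ?_) hn.le
    rw [← Real.rpow_mul hn0.le, mul_left_comm, ← Real.rpow_natCast, ← Real.rpow_add hn0]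
    congr 2
    push_cast
    ring
  refine ⟨C, hC0, ?_⟩
  filter_upwards [hG.eventually_mean_le hB1 hB hsparse,
    IsRandomGraphSequence.eventually_variance_mul_log_le hvar, hsqrt, hlarge, htail,
    eventually_mul_log_mul_rpow_le (440 * B) (show (0 : ℝ) < 1 / 2 by norm_num),
    eventually_mul_log_mul_rpow_le 220 (show (1 / 3 : ℝ) < 1 / 2 by norm_num),
    eventually_ge_atTop 8] with n hμ1 hv hsqrt hlarge htail hlogA hlogB hn
  rw [← Real.sqrt_eq_rpow] at hlogA hlogB
  rw [Real.rpow_zero, mul_one] at hlogA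
  have hn0 : (0 : ℝ) < n := by exact_mod_cast (by omega : 0 < n)
  have hn1 : (1 : ℝ) ≤ n := by exact_mod_cast (by omega : 1 ≤ n)
  rw [mul_assoc]
  rcases le_or_gt (μ n) 0 with hμ | hμ
  · have h1 : 1 ≤ Real.exp (-C * (μ n * n)) := by
      rw [Real.one_le_exp_iff]
      exact mul_nonneg_of_nonpos_of_nonpos (by linarith)
        (mul_nonpos_of_nonpos_of_nonneg hμ hn0.le)
    exact (sub_nonpos.2 h1).trans measureReal_nonneg
  have hX := hG.isCenteredFamily hB n
  have hμn0 : 0 < μ n * n := by positivity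
  rcases le_total 1 (μ n * n) with hμn | hμn
  · have h1 := measureReal_not_satisfiesBrouwer_le hX hμ hμ1 hμn hn hB1 (sq_nonneg _)
      (hG.sq_le_sq_of_bounded hB (by omega)) (hv hμ) hlogA
    have h2 : Real.exp (-(1 / (3000 * B ^ 2)) * (μ n * n)) ≤ Real.exp (-C * (μ n * n)) := by
      gcongr
      exact min_le_left _ _
    linarith [one_sub_measureReal_not_le P fun ω => (G n ω).SatisfiesBrouwer]
  · have h1 := le_measureReal_satisfiesBrouwer (r := (n : ℝ) ^ (1 / 3 : ℝ)) hX
      (hG.sd_pos n (by omega)) hG.integral_sub_mean_sq (by linarith) hM1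
      (fun e => hM n _ _ e.2) hμ hμ1 hn (hv hμ) (Real.one_le_rpow hn1 (by norm_num))
      (by rw [← Real.rpow_natCast, ← Real.rpow_mul hn0.le]; norm_num) hlogB hsqrt htail hlarge
    refine le_trans ?_ h1
    have h2 := Real.add_one_le_exp (-C * (μ n * n))
    have h3 : C * (μ n * n) ≤ c₀ / 2 * 1 := by
      gcongr
      exact min_le_right _ _
    linarith
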